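/- For strings $x,y$ over an alphabet $\Sigma$, a site-directed insertion (SDI) of $y$ into $x$ is a string $x_1uzvx_2$ where $x=x_1uvx_2$, $y=uzv$, $u\neq\varepsilon$, $v\neq\varepsilon$. It is maximal if there exist no suffix $x_1'$ of $x_1$ and prefix $x_2'$ of $x_2$ with $x_1'x_2'\neq\varepsilon$ and $y=x_1'uz'vx_2'$ for some $z'\in\Sigma^*$. It is minimal if no proper nonempty suffix of $u$ is a prefix of $u$ and no proper nonempty prefix of $v$ is a suffix of $v$. A language $L$ is SDI-free (respectively maximal SDI-free, minimal SDI-free) with respect to a language $R$ if there is no SDI (respectively no maximal SDI, no minimal SDI) of a string of $R$ into a string of $L$. Given nondeterministic finite automata $A$ and $B$ over a common finite alphabet (the alphabet being part of the input), one can decide in polynomial time whether or not $L(A)$ is maximal SDI-free with respect to $L(B)$, and one can decide in polynomial time whether or not $L(A)$ is minimal SDI-free with respect to $L(B)$. Moreover, for all languages $L,R$ over the same alphabet, $L$ is maximal SDI-free with respect to $R$ if and only if $L$ is SDI-free with respect to $R$, and $L$ is minimal SDI-free with respect to $R$ if and only if $L$ is SDI-free with respect to $R$. -/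

import Mathlib

namespace SDI

/-! ### Site-directed insertion of strings -/

/-- Site-directed insertion of `y` into `x`. -/
def sdi {α : Type*} (x y : List α) : Set (List α) :=
  {w | ∃ x₁ u z v x₂ : List α, w = x₁ ++ u ++ z ++ v ++ x₂ ∧
    x = x₁ ++ u ++ v ++ x₂ ∧ y = u ++ z ++ v ∧ u ≠ [] ∧ v ≠ []}

/-- Maximal site-directed insertion of `y` into `x`: the matched outfix `(u, v)` of `y` cannot be
properly extended at the same position of `x`. -/
def maxSDI {α : Type*} (x y : List α) : Set (List α) :=
  {w | ∃ x₁ u z v x₂ : List α, w = x₁ ++ u ++ z ++ v ++ x₂ ∧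
    x = x₁ ++ u ++ v ++ x₂ ∧ y = u ++ z ++ v ∧ u ≠ [] ∧ v ≠ [] ∧
    ¬ ∃ x₁' x₂' z' : List α, x₁' <:+ x₁ ∧ x₂' <+: x₂ ∧ x₁' ++ x₂' ≠ [] ∧
      y = x₁' ++ u ++ z' ++ v ++ x₂'}

/-- Minimal site-directed insertion of `y` into `x`: no proper nonempty suffix of `u` is a prefix
of `u`, and no proper nonempty prefix of `v` is a suffix of `v`. -/
def minSDI {α : Type*} (x y : List α) : Set (List α) :=
  {w | ∃ x₁ u z v x₂ : List α, w = x₁ ++ u ++ z ++ v ++ x₂ ∧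
    x = x₁ ++ u ++ v ++ x₂ ∧ y = u ++ z ++ v ∧ u ≠ [] ∧ v ≠ [] ∧
    (¬ ∃ b : List α, b ≠ [] ∧ b ≠ u ∧ b <:+ u ∧ b <+: u) ∧
    (¬ ∃ b : List α, b ≠ [] ∧ b ≠ v ∧ b <+: v ∧ b <:+ v)}

/-- Extension of an operation on strings to languages. -/
def liftOp {α : Type*} (op : List α → List α → Set (List α)) (L R : Language α) :
    Set (List α) :=
  {w | ∃ x ∈ L, ∃ y ∈ R, w ∈ op x y}

/-- `L` is free with respect to `R` for the operation `op`: the language obtained by applying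
`op` to `L` and `R` is empty. -/
def IsFree {α : Type*} (op : List α → List α → Set (List α)) (L R : Language α) : Prop :=
  liftOp op L R = ∅

/-! ### Finite automata as finite data -/

/-- A nondeterministic finite automaton with a single initial state, over the alphabet
`{0, …, k - 1}` and with state set `{0, …, n - 1}`. -/
structure FinNFA (k : ℕ) where
  /-- number of states -/
  n : ℕ
  /-- transition function -/
  δ : Fin n → Fin k → Finset (Fin n)
  /-- initial state -/
  q₀ : Fin n
  /-- final states -/
  F : Finset (Fin n)

/-- The automaton as a Mathlib `NFA`. -/
def FinNFA.toNFA {k : ℕ} (A : FinNFA k) : NFA (Fin k) (Fin A.n) where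
  step p a := {q | q ∈ A.δ p a}
  start := {A.q₀}
  accept := {q | q ∈ A.F}

/-- The language accepted by the automaton. -/
def FinNFA.lang {k : ℕ} (A : FinNFA k) : Language (Fin k) :=
  A.toNFA.accepts

/-- An instance of the decision problems: an alphabet and two automata over it. -/
structure NFAPair where
  /-- size of the common alphabet -/
  k : ℕ
  /-- the first automaton -/
  A : FinNFA k
  /-- the second automaton -/
  B : FinNFA k

/-! ### Encoding of the instances as binary strings

The length of the encoding lies between (a constant times) the number of letters, states, final
states and transitions, and a polynomial in these numbers. -/

/-- A number, such as the index of a state or of a letter, in unary: `m` is `1ᵐ0`. -/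
def encNat (m : ℕ) : List Bool :=
  List.replicate m true ++ [false]

/-- A list of encoded items: each item is preceded by `1`, and the list is closed by `0`. -/
def encList : List (List Bool) → List Bool
  | [] => [false]
  | w :: ws => true :: (w ++ encList ws)

/-- The list of all transitions `(p, a, q)` with `q ∈ δ(p, a)`. -/
def FinNFA.transitions {k : ℕ} (A : FinNFA k) : List (Fin A.n × Fin k × Fin A.n) :=
  (List.finRange A.n).flatMap fun p => (List.finRange k).flatMap fun a =>
    ((List.finRange A.n).filter fun q => q ∈ A.δ p a).map fun q => (p, a, q)

/-- Encoding of an automaton: the number of states, the initial state, the list of the final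
states, the list of the transitions. -/
def FinNFA.enc {k : ℕ} (A : FinNFA k) : List Bool :=
  encNat A.n ++ encNat A.q₀ ++
  encList (((List.finRange A.n).filter fun q => q ∈ A.F).map fun q : Fin A.n => encNat q) ++
  encList (A.transitions.map fun t => encNat t.1 ++ encNat t.2.1 ++ encNat t.2.2)

/-- Encoding of an instance: the size of the alphabet and the two automata. -/
def NFAPair.enc (I : NFAPair) : List Bool :=
  encNat I.k ++ I.A.enc ++ I.B.enc

/-- The problem `P` on inputs encoded by `enc` is decidable in polynomial time: some Turing
machine answers `P` correctly on every input `a`, within a number of steps bounded by a fixed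
polynomial in the length of `enc a`. -/
def DecidableInPolyTime {ι : Type} (enc : ι → List Bool) (P : ι → Prop) : Prop :=
  ∃ f : ι → Bool, (∀ a, f a = true ↔ P a) ∧
    Nonempty (Turing.TM2ComputableInPolyTime enc Computability.encodeBool f)

end SDI

/-! The equivalences hold pair by pair. If some insertion of `y` into `x` exists, a maximal one
exists: while the matched outfix `(u, v)` can be extended, absorb the extension, which shortens `x₁`
and `x₂`. A minimal one exists as well: if `u` has a proper nonempty border `b`, match only `b`,
read as the end of `u` inside `x` and as the beginning of `u` inside `y`; likewise for `v`. The
resulting string may change, but freeness only asks whether one exists (`isFree_maxSDI_iff`,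
`isFree_minSDI_iff`). So both decision problems reduce to SDI-freeness.

SDI-freeness fails exactly when there are words with `x ++ u ++ v ++ y` in L(A) and `u ++ z ++ v` in
L(B), where `u` and `v` are nonempty. This is reachability in a product graph with five phases: A
alone reads `x` (1), both read `u` (2), B alone reads `z` (3), both read `v` (4), A alone reads `y`
(5). The last letter of `u` leads into phase 3 and the last letter of `v` into phase 5, which forces
both words to be nonempty. A final edge leads from pairs of final states in phase 5 to the vertex
`(0, 0)`. `NFAPair.hits_iff_witness` proves the equivalence with reachability of a vertex with
second component `0`.

Polynomial time refers to actual Turing machines. Algorithms are therefore written in a small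
structured language `Prog` on stacks of numbers, whose big-step semantics counts machine steps;
`Run.steps` shows that the compiled multi-stack machine takes exactly that many steps. The program
`decideFree` turns each automaton into a list of labelled edges, forms the product by joining edges
with equal labels, and runs a worklist search that deletes each edge when it is used. Deletion makes
the number of waiting vertices plus remaining edges a decreasing measure (`length_follow`) and loses
no hit (`hits_cons`); this yields `leads_vertices` and the bound `decideFreeTime`. -/

namespace SDI

/-! ### A structured language of programs on stacks of numbers -/

/-- Programs acting on finitely many stacks of natural numbers. -/
inductive Prog (K : Type) : Type
  /-- do nothing -/
  | skip : Prog K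
  /-- push the number `0` -/
  | push (k : K) : Prog K
  /-- increment the top number -/
  | inc (k : K) : Prog K
  /-- empty the stack -/
  | clear (k : K) : Prog K
  /-- composition -/
  | seq (p q : Prog K) : Prog K
  /-- if the top number is `0`, remove it and run `p`; otherwise decrement it and run `q` -/
  | ifz (k : K) (p q : Prog K) : Prog K
  /-- as long as the top number is positive, decrement it and run `p`; then remove it -/
  | loop (k : K) (p : Prog K) : Prog K

/-- A stack of numbers as a stack of bits. -/
def bits (l : List ℕ) : List Bool := l.flatMap encNat

theorem bits_cons (n : ℕ) (l : List ℕ) : bits (n :: l) = encNat n ++ bits l := rfl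

theorem bits_zero_cons (l : List ℕ) : bits (0 :: l) = false :: bits l := rfl

theorem bits_succ_cons (n : ℕ) (l : List ℕ) : bits ((n + 1) :: l) = true :: bits (n :: l) := rfl

namespace Prog

variable {K : Type} [DecidableEq K]

/-- Big-step semantics with running time. -/
inductive Run : Prog K → (K → List ℕ) → (K → List ℕ) → ℕ → Prop
  | skip (s) : Run skip s s 1
  | push (k s) : Run (push k) s (Function.update s k (0 :: s k)) 1
  | inc {k s n l} (h : s k = n :: l) : Run (inc k) s (Function.update s k ((n + 1) :: l)) 1
  | clear (k s) : Run (clear k) s (Function.update s k []) ((bits (s k)).length + 1)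
  | seq {p q s s₁ s₂ t₁ t₂} (h₁ : Run p s s₁ t₁) (h₂ : Run q s₁ s₂ t₂) :
      Run (seq p q) s s₂ (t₁ + t₂)
  | ifz_zero {k p q s s' l t} (h : s k = 0 :: l) (hp : Run p (Function.update s k l) s' t) :
      Run (ifz k p q) s s' (t + 1)
  | ifz_succ {k p q s s' n l t} (h : s k = (n + 1) :: l)
      (hq : Run q (Function.update s k (n :: l)) s' t) : Run (ifz k p q) s s' (t + 1)
  | loop_zero {k p s l} (h : s k = 0 :: l) : Run (loop k p) s (Function.update s k l) 1
  | loop_succ {k p s s₁ s₂ n l t₁ t₂} (h : s k = (n + 1) :: l)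
      (h₁ : Run p (Function.update s k (n :: l)) s₁ t₁) (h₂ : Run (loop k p) s₁ s₂ t₂) :
      Run (loop k p) s s₂ (t₁ + t₂ + 1)

/-! ### Compilation to a multi-stack Turing machine -/

/-- The labels of the compiled program. -/
def Lbl : Prog K → Type
  | skip | push _ | inc _ | clear _ => Unit
  | seq p q => Lbl p ⊕ Lbl q
  | ifz _ p q => Option (Lbl p ⊕ Lbl q)
  | loop _ p => Option (Lbl p)

instance fintypeLbl : (p : Prog K) → Fintype (Lbl p)
  | skip | push _ | inc _ | clear _ => inferInstanceAs (Fintype Unit)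
  | seq p q =>
    letI := fintypeLbl p
    letI := fintypeLbl q
    inferInstanceAs (Fintype (Lbl p ⊕ Lbl q))
  | ifz _ p q =>
    letI := fintypeLbl p
    letI := fintypeLbl q
    inferInstanceAs (Fintype (Option (Lbl p ⊕ Lbl q)))
  | loop _ p =>
    letI := fintypeLbl p
    inferInstanceAs (Fintype (Option (Lbl p)))

/-- The first label of the compiled program. -/
def entry : (p : Prog K) → Lbl p
  | skip | push _ | inc _ | clear _ => ()
  | seq p _ => Sum.inl (entry p)
  | ifz _ _ _ => none
  | loop _ _ => none

/-- The statements of the compiled program, embedded into a machine with labels `Λ` by `e`, with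
exit label `x`. -/
def code {Λ : Type} : (p : Prog K) → (Lbl p → Λ) → Λ → Lbl p →
    Turing.TM2.Stmt (fun _ : K => Bool) Λ (Option Bool)
  | skip, _, x, _ => Turing.TM2.Stmt.goto fun _ => x
  | push k, _, x, _ => Turing.TM2.Stmt.push k (fun _ => false) (Turing.TM2.Stmt.goto fun _ => x)
  | inc k, _, x, _ => Turing.TM2.Stmt.push k (fun _ => true) (Turing.TM2.Stmt.goto fun _ => x)
  | clear k, e, x, () => Turing.TM2.Stmt.pop k (fun _ o => o) (Turing.TM2.Stmt.branch Option.isSome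
      (Turing.TM2.Stmt.goto fun _ => e ()) (Turing.TM2.Stmt.goto fun _ => x))
  | seq p q, e, _, Sum.inl l =>
    code p (fun l => e (Sum.inl l)) (e (Sum.inr (entry q))) l
  | seq _ q, e, x, Sum.inr l => code q (fun l => e (Sum.inr l)) x l
  | ifz k p q, e, _, none =>
    Turing.TM2.Stmt.pop k (fun _ o => o) (Turing.TM2.Stmt.branch (fun o => o == some true)
      (Turing.TM2.Stmt.goto fun _ => e (some (Sum.inr (entry q))))
      (Turing.TM2.Stmt.goto fun _ => e (some (Sum.inl (entry p)))))
  | ifz _ p _, e, x, some (Sum.inl l) => code p (fun l => e (some (Sum.inl l))) x l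
  | ifz _ _ q, e, x, some (Sum.inr l) => code q (fun l => e (some (Sum.inr l))) x l
  | loop k p, e, x, none =>
    Turing.TM2.Stmt.pop k (fun _ o => o) (Turing.TM2.Stmt.branch (fun o => o == some true)
      (Turing.TM2.Stmt.goto fun _ => e (some (entry p))) (Turing.TM2.Stmt.goto fun _ => x))
  | loop _ p, e, _, some l => code p (fun l => e (some l)) (e none) l

/-! ### Simulation of the big-step semantics by the compiled machine. -/

section Simulation

variable {Λ : Type} (M : Λ → Turing.TM2.Stmt (fun _ : K => Bool) Λ (Option Bool))

/-- The machine `M` passes from the configuration `c` to `c'` in exactly `t` steps. -/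
def Steps (c c' : Turing.TM2.Cfg (fun _ : K => Bool) Λ (Option Bool)) (t : ℕ) : Prop :=
  (flip bind (Turing.TM2.step M))^[t] (some c) = some c'

variable {M}

theorem Steps.single {c c' : Turing.TM2.Cfg (fun _ : K => Bool) Λ (Option Bool)}
    (h : Turing.TM2.step M c = some c') : Steps M c c' 1 := h

theorem Steps.trans {c₁ c₂ c₃ : Turing.TM2.Cfg (fun _ : K => Bool) Λ (Option Bool)} {t₁ t₂ : ℕ}
    (h₁ : Steps M c₁ c₂ t₁) (h₂ : Steps M c₂ c₃ t₂) : Steps M c₁ c₃ (t₁ + t₂) := by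
  unfold Steps at *
  rw [Nat.add_comm, Function.iterate_add_apply, h₁, h₂]

/-- The bit stacks that represent the stacks of numbers. -/
def store (s : K → List ℕ) : K → List Bool := fun k => bits (s k)

theorem store_update (s : K → List ℕ) (k : K) (l : List ℕ) :
    store (Function.update s k l) = Function.update (store s) k (bits l) := by
  funext j
  by_cases h : j = k
  · subst h; simp [store]
  · simp [store, h]

theorem store_single (k : K) (l : List ℕ) :
    store (Function.update (fun _ => []) k l) = fun j => if j = k then bits l else [] := by
  funext j
  by_cases h : j = k
  · subst h; simp [store]
  · simp [store, h, bits]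

/-- Each step pops one bit and returns to the same label; the additional step discovers that the
stack is empty. -/
theorem steps_clear {S : K → List Bool} {k : K} {l x : Λ}
    (hM : M l = code (clear k) (fun _ => l) x ()) (v : Option Bool) :
    ∃ v', Steps M ⟨some l, v, S⟩ ⟨some x, v', Function.update S k []⟩ ((S k).length + 1) := by
  induction hn : (S k).length generalizing S v with
  | zero =>
    have h0 : S k = [] := List.length_eq_zero_iff.mp hn
    refine ⟨none, Steps.single ?_⟩
    simp [Turing.TM2.step, hM, code, h0]
  | succ n ih =>
    obtain ⟨b, r, hr⟩ : ∃ b r, S k = b :: r := List.exists_cons_of_length_eq_add_one hn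
    obtain ⟨v', h'⟩ := ih (S := Function.update S k r) (some b) (by simp_all)
    refine ⟨v', ?_⟩
    rw [show n + 1 + 1 = 1 + (n + 1) by omega]
    refine Steps.trans (Steps.single ?_) (by simpa using h')
    simp [Turing.TM2.step, hM, code, hr]

/-- The embedding `e`, the exit label `x` and the internal state `v` are quantified inside the
induction because subprograms are embedded in larger ones, with other exits. The step count is
exact: each label carries one statement ending in a jump, which the machine executes as one step. -/
theorem Run.steps {p : Prog K} {s s' : K → List ℕ} {t : ℕ} (h : Run p s s' t) :
    ∀ (e : Lbl p → Λ) (x : Λ) (_ : ∀ l, M (e l) = code p e x l) (v : Option Bool),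
      ∃ v', Steps M ⟨some (e (entry p)), v, store s⟩ ⟨some x, v', store s'⟩ t := by
  induction h with
  | skip s =>
    intro e x hM v
    exact ⟨v, Steps.single (by simp [Turing.TM2.step, hM, code])⟩
  | push k s =>
    intro e x hM v
    refine ⟨v, Steps.single ?_⟩
    simp [Turing.TM2.step, hM, code, store_update, bits_zero_cons]
    rfl
  | @inc k s n l h =>
    intro e x hM v
    refine ⟨v, Steps.single ?_⟩
    simp [Turing.TM2.step, hM, code, store_update, bits_succ_cons, ← h]
    rfl
  | clear k s =>
    intro e x hM v
    obtain ⟨v', h⟩ := steps_clear (M := M) (S := store s) (k := k) (l := e ()) (x := x) (hM ()) v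
    refine ⟨v', ?_⟩
    rw [store_update]
    exact h
  | @seq p q s s₁ s₂ t₁ t₂ h₁ h₂ ih₁ ih₂ =>
    intro e x hM v
    obtain ⟨v₁, h₁⟩ := ih₁ (fun l => e (Sum.inl l)) (e (Sum.inr (entry q)))
      (fun l => hM (Sum.inl l)) v
    obtain ⟨v₂, h₂⟩ := ih₂ (fun l => e (Sum.inr l)) x (fun l => hM (Sum.inr l)) v₁
    exact ⟨v₂, h₁.trans h₂⟩
  | @ifz_zero k p q s s' l t h hp ih =>
    intro e x hM v
    obtain ⟨v₁, h₁⟩ := ih (fun l => e (some (Sum.inl l))) x (fun l => hM (some (Sum.inl l))) (some false)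
    refine ⟨v₁, ?_⟩
    rw [Nat.add_comm]
    have h0 : M (e (entry (ifz k p q))) = Turing.TM2.Stmt.pop k (fun _ o => o)
      (Turing.TM2.Stmt.branch (fun o => o == some true)
        (Turing.TM2.Stmt.goto fun _ => e (some (Sum.inr (entry q))))
        (Turing.TM2.Stmt.goto fun _ => e (some (Sum.inl (entry p))))) := hM _
    refine Steps.trans (Steps.single ?_) h₁
    have h2 : store s k = false :: bits l := by rw [store, h, bits_zero_cons]
    simp [Turing.TM2.step, h0, store_update, h2]
  | @ifz_succ k p q s s' n l t h hp ih =>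
    intro e x hM v
    obtain ⟨v₁, h₁⟩ := ih (fun l => e (some (Sum.inr l))) x (fun l => hM (some (Sum.inr l))) (some true)
    refine ⟨v₁, ?_⟩
    rw [Nat.add_comm]
    have h0 : M (e (entry (ifz k p q))) = Turing.TM2.Stmt.pop k (fun _ o => o)
      (Turing.TM2.Stmt.branch (fun o => o == some true)
        (Turing.TM2.Stmt.goto fun _ => e (some (Sum.inr (entry q))))
        (Turing.TM2.Stmt.goto fun _ => e (some (Sum.inl (entry p))))) := hM _
    refine Steps.trans (Steps.single ?_) h₁
    have h2 : store s k = true :: bits (n :: l) := by rw [store, h, bits_succ_cons]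
    simp [Turing.TM2.step, h0, store_update, h2]
  | @loop_zero k p s l h =>
    intro e x hM v
    have h0 : M (e (entry (loop k p))) = Turing.TM2.Stmt.pop k (fun _ o => o)
      (Turing.TM2.Stmt.branch (fun o => o == some true) (Turing.TM2.Stmt.goto fun _ => e (some (entry p)))
        (Turing.TM2.Stmt.goto fun _ => x)) := hM _
    refine ⟨some false, Steps.single ?_⟩
    have h2 : store s k = false :: bits l := by rw [store, h, bits_zero_cons]
    simp [Turing.TM2.step, h0, store_update, h2]
  | @loop_succ k p s s₁ s₂ n l t₁ t₂ h h₁ h₂ ih₁ ih₂ =>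
    intro e x hM v
    obtain ⟨v₁, h₁⟩ := ih₁ (fun l => e (some l)) (e none) (fun l => hM (some l)) (some true)
    obtain ⟨v₂, h₂⟩ := ih₂ e x hM v₁
    refine ⟨v₂, ?_⟩
    rw [Nat.add_comm]
    have h0 : M (e (entry (loop k p))) = Turing.TM2.Stmt.pop k (fun _ o => o)
      (Turing.TM2.Stmt.branch (fun o => o == some true) (Turing.TM2.Stmt.goto fun _ => e (some (entry p)))
        (Turing.TM2.Stmt.goto fun _ => x)) := hM _
    refine Steps.trans (Steps.single ?_) (h₁.trans h₂)
    have h2 : store s k = true :: bits (n :: l) := by rw [store, h, bits_succ_cons]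
    simp [Turing.TM2.step, h0, store_update, h2]

end Simulation

/-- The statements of the Turing machine running `p` with output stack `o`. When `p` has
terminated, a positive number on top of the stack `o` is replaced by the answer `true`, and `0` by
the answer `false`. -/
def machineCode (p : Prog K) (o : K) :
    Option (Lbl p) → Turing.TM2.Stmt (fun _ : K => Bool) (Option (Lbl p)) (Option Bool)
  | none => Turing.TM2.Stmt.pop o (fun _ b => b)
      (Turing.TM2.Stmt.branch (fun b => b == some true)
        -- The number `1` occupies the bits `true, false`, so a second `pop` removes the closing
        -- bit. A halting configuration must also have the initial internal state, hence the `load`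
        -- of `none`.
        (Turing.TM2.Stmt.pop o (fun _ b => b) (Turing.TM2.Stmt.push o (fun _ => true)
          (Turing.TM2.Stmt.load (fun _ => none) Turing.TM2.Stmt.halt)))
        (Turing.TM2.Stmt.push o (fun _ => false)
          (Turing.TM2.Stmt.load (fun _ => none) Turing.TM2.Stmt.halt)))
  | some l => code p some none l

/-- The Turing machine running `p` with input stack `i` and output stack `o`. -/
def machine [Fintype K] (p : Prog K) (i o : K) : Turing.FinTM2 where
  K := K
  k₀ := i
  k₁ := o
  Γ := fun _ => Bool
  Λ := Option (Lbl p)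
  main := some (entry p)
  σ := Option Bool
  initialState := none
  Γk₀Fin := inferInstanceAs (Fintype Bool)
  m := machineCode p o

theorem steps_machineCode (p : Prog K) (o : K) {s : K → List ℕ} {t : ℕ} {b : Bool}
    (h : Run p s (Function.update (fun _ => []) o [b.toNat]) t) :
    Steps (machineCode p o) ⟨some (some (entry p)), none, store s⟩
      ⟨none, none, fun j => if j = o then [b] else []⟩ (t + 1) := by
  obtain ⟨v, hv⟩ := h.steps (M := machineCode p o) some none (fun _ => rfl) none
  refine hv.trans (Steps.single ?_)
  have h : (fun j => if j = o then [b] else []) = Function.update (fun _ => []) o [b] := by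
    funext j
    by_cases h : j = o
    · subst h; simp
    · simp [h]
  rw [h, store_update]
  have h0 : store (fun _ : K => []) = fun _ => [] := rfl
  cases b <;> simp [Turing.TM2.step, machineCode, bits, encNat, h0, List.replicate]

/-- A machine that outputs a result must halt with all stacks other than the output stack empty,
which is why the run has to end in such a store. The summand `1` in the time pays for the final
answer statement of `machineCode`. -/
theorem decidableInPolyTime [Fintype K] {ι : Type} {enc : ι → List Bool} {P : ι → Prop}
    (p : Prog K) (i o : K) (T : Polynomial ℕ) (input : ι → List ℕ)
    (henc : ∀ a, enc a = bits (input a))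
    (h : ∀ a, ∃ t ≤ T.eval (enc a).length, ∃ b : Bool, (b = true ↔ P a) ∧
      Run p (Function.update (fun _ => []) i (input a))
        (Function.update (fun _ => []) o [b.toNat]) t) :
    DecidableInPolyTime enc P := by
  choose t ht f hf hrun using h
  refine ⟨f, hf, ⟨{
    tm := machine p i o
    inputAlphabet := Equiv.refl Bool
    outputAlphabet := Equiv.refl Bool
    time := T + 1
    outputsFun := fun a => ⟨⟨t a + 1, ?_⟩, ?_⟩ }⟩⟩
  · have h := steps_machineCode p o (hrun a)
    rw [store_single, ← henc] at h
    -- Computability transports input and output along the alphabet equivalences; inserting these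
    -- trivial maps gives the expected form.
    have hid : ∀ l : List Bool, l.map (Equiv.refl Bool).invFun = l := fun l => List.map_id l
    rw [← hid (enc a), ← hid [f a]] at h
    exact h
  · simp only [Polynomial.eval_add, Polynomial.eval_one]
    exact Nat.add_le_add_right (ht a) 1

/-! ### Programs with bounds on the running time -/

/-- The program `p` leads from `s` to `s'` in at most `T` steps. -/
def Runs (p : Prog K) (s s' : K → List ℕ) (T : ℕ) : Prop := ∃ t ≤ T, Run p s s' t

theorem Run.runs {p : Prog K} {s s' : K → List ℕ} {t T : ℕ} (h : Run p s s' t) (hT : t ≤ T) :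
    Runs p s s' T := ⟨t, hT, h⟩

theorem Runs.mono {p : Prog K} {s s' : K → List ℕ} {t T : ℕ} (h : Runs p s s' t) (hT : t ≤ T) :
    Runs p s s' T := let ⟨u, hu, hr⟩ := h; ⟨u, hu.trans hT, hr⟩

theorem Runs.congr {p : Prog K} {s s₁ s₂ : K → List ℕ} {T : ℕ} (h : Runs p s s₁ T)
    (hs : s₁ = s₂) : Runs p s s₂ T := hs ▸ h

theorem Runs.skip (s : K → List ℕ) : Runs skip s s 1 := (Run.skip s).runs le_rfl

theorem Runs.push (k : K) (s : K → List ℕ) :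
    Runs (push k) s (Function.update s k (0 :: s k)) 1 := (Run.push k s).runs le_rfl

theorem Runs.inc {k : K} {s : K → List ℕ} {n : ℕ} {l : List ℕ} (h : s k = n :: l) :
    Runs (inc k) s (Function.update s k ((n + 1) :: l)) 1 := (Run.inc h).runs le_rfl

theorem Runs.clear (k : K) (s : K → List ℕ) :
    Runs (clear k) s (Function.update s k []) ((bits (s k)).length + 1) :=
  (Run.clear k s).runs le_rfl

theorem Runs.seq {p q : Prog K} {s s₁ s₂ : K → List ℕ} {t₁ t₂ : ℕ} (h₁ : Runs p s s₁ t₁)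
    (h₂ : Runs q s₁ s₂ t₂) : Runs (seq p q) s s₂ (t₁ + t₂) :=
  let ⟨_, hu₁, hr₁⟩ := h₁
  let ⟨_, hu₂, hr₂⟩ := h₂
  ⟨_, Nat.add_le_add hu₁ hu₂, hr₁.seq hr₂⟩

theorem Runs.ifz_zero {k : K} {p q : Prog K} {s s' : K → List ℕ} {l : List ℕ} {t : ℕ}
    (h : s k = 0 :: l) (hp : Runs p (Function.update s k l) s' t) :
    Runs (ifz k p q) s s' (t + 1) :=
  let ⟨_, hu, hr⟩ := hp
  ⟨_, Nat.add_le_add_right hu 1, hr.ifz_zero h⟩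

theorem Runs.ifz_succ {k : K} {p q : Prog K} {s s' : K → List ℕ} {n : ℕ} {l : List ℕ} {t : ℕ}
    (h : s k = (n + 1) :: l) (hp : Runs q (Function.update s k (n :: l)) s' t) :
    Runs (ifz k p q) s s' (t + 1) :=
  let ⟨_, hu, hr⟩ := hp
  ⟨_, Nat.add_le_add_right hu 1, hr.ifz_succ h⟩

theorem Runs.loop_zero {k : K} {p : Prog K} {s : K → List ℕ} {l : List ℕ} (h : s k = 0 :: l) :
    Runs (loop k p) s (Function.update s k l) 1 := (Run.loop_zero h).runs le_rfl

theorem Runs.loop_succ {k : K} {p : Prog K} {s s₁ s₂ : K → List ℕ} {n : ℕ} {l : List ℕ}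
    {t₁ t₂ : ℕ} (h : s k = (n + 1) :: l) (h₁ : Runs p (Function.update s k (n :: l)) s₁ t₁)
    (h₂ : Runs (loop k p) s₁ s₂ t₂) : Runs (loop k p) s s₂ (t₁ + t₂ + 1) :=
  let ⟨_, hu₁, hr₁⟩ := h₁
  let ⟨_, hu₂, hr₂⟩ := h₂
  ⟨_, by omega, hr₁.loop_succ h hr₂⟩

/-- A loop that counts down from `n`, described by the family `S` of the stores at the tests. -/
theorem Runs.loop_count {k : K} {p : Prog K} {T : ℕ} (S : ℕ → K → List ℕ) (l : List ℕ)
    (hk : ∀ m, S m k = m :: l) (n : ℕ)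
    (hp : ∀ m < n, Runs p (Function.update (S (m + 1)) k (m :: l)) (S m) T) :
    Runs (loop k p) (S n) (Function.update (S 0) k l) (n * (T + 1) + 1) := by
  induction n with
  | zero => exact (loop_zero (hk 0)).mono (by omega)
  | succ n ih =>
    refine (loop_succ (hk (n + 1)) (hp n (Nat.lt_succ_self n))
      (ih fun m hm => hp m (Nat.lt_succ_of_lt hm))).mono (le_of_eq ?_)
    ring

/-- A loop that works through a list and accumulates data of type `β`. -/
theorem Runs.loop_foldl {α β : Type*} {k : K} {p : Prog K} {T : ℕ} (f : β → α → β)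
    (F : List α → β → K → List ℕ) (G : β → K → List ℕ)
    (hz : ∀ b, ∃ r, F [] b k = 0 :: r ∧ Function.update (F [] b) k r = G b) (l : List α)
    (hs : ∀ a ∈ l, ∀ l' b, ∃ m r, F (a :: l') b k = (m + 1) :: r ∧
      Runs p (Function.update (F (a :: l') b) k (m :: r)) (F l' (f b a)) T) (b : β) :
    Runs (loop k p) (F l b) (G (l.foldl f b)) (l.length * (T + 1) + 1) := by
  induction l generalizing b with
  | nil =>
    obtain ⟨r, h1, h2⟩ := hz b
    simpa [h2] using (loop_zero (p := p) h1)
  | cons a l ih =>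
    obtain ⟨m, r, h1, h2⟩ := hs a List.mem_cons_self l b
    refine (loop_succ h1 h2 (ih (fun a ha => hs a (List.mem_cons_of_mem _ ha)) _)).mono
      (le_of_eq ?_)
    simp only [List.length_cons]
    ring

/-! ### Basic programs -/

/-- Remove the top number of the stack `k`. -/
def drop (k : K) : Prog K := loop k skip

theorem Runs.drop {k : K} {s : K → List ℕ} {n : ℕ} {l : List ℕ} (h : s k = n :: l) :
    Runs (drop k) s (Function.update s k l) (2 * n + 1) := by
  have := loop_count (k := k) (p := Prog.skip) (T := 1) (fun m => Function.update s k (m :: l)) l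
    (by simp) n (fun m _ => by simpa using skip _)
  rw [← h, Function.update_eq_self] at this
  simp only [Function.update_idem] at this
  exact this.mono (by omega)

/-- Add `c` to the top number of the stack `k`. -/
def addConst (k : K) : ℕ → Prog K
  | 0 => skip
  | c + 1 => seq (inc k) (addConst k c)

theorem Runs.addConst {k : K} (c : ℕ) {s : K → List ℕ} {n : ℕ} {l : List ℕ} (h : s k = n :: l) :
    Runs (addConst k c) s (Function.update s k ((n + c) :: l)) (c + 1) := by
  induction c generalizing s n with
  | zero =>
    rw [Nat.add_zero, ← h, Function.update_eq_self]
    exact skip s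
  | succ c ih =>
    have := seq (inc h) (ih (s := Function.update s k ((n + 1) :: l)) (n := n + 1) (by simp))
    rw [Function.update_idem, show n + 1 + c = n + (c + 1) by omega] at this
    exact this.mono (by omega)

/-- Move the top number of the stack `x` to the stack `y`. -/
def move (x y : K) : Prog K := seq (push y) (loop x (inc y))

/-- Loop invariant: with `m` left on `x`, the number built on `y` is `n - m`. -/
theorem Runs.move {x y : K} (hxy : x ≠ y) {s : K → List ℕ} {n : ℕ} {l : List ℕ}
    (h : s x = n :: l) :
    Runs (move x y) s (Function.update (Function.update s x l) y (n :: s y)) (2 * n + 2) := by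
  have := loop_count (k := x) (p := Prog.inc y) (T := 1)
    (fun m => Function.update (Function.update s x (m :: l)) y ((n - m) :: s y)) l
    (by simp [hxy]) n (fun m hm => by
      have := inc (k := y) (s := Function.update (Function.update
        (Function.update s x ((m + 1) :: l)) y ((n - (m + 1)) :: s y)) x (m :: l))
        (n := n - (m + 1)) (l := s y) (by simp [hxy.symm])
      convert this using 1
      funext k
      by_cases hy : k = y
      · subst hy; simp; omega
      · by_cases hx : k = x
        · subst hx; simp [hxy]
        · simp [hx, hy])
  refine Runs.mono (t := 1 + (n * (1 + 1) + 1)) ((push y s).seq ?_) (by omega)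
  convert this using 1
  · simp [← h]
  · funext k
    by_cases hy : k = y
    · subst hy; simp [hxy.symm]
    · by_cases hx : k = x
      · subst hx; simp [hxy]
      · simp [hx, hy]

/-- Push `m * n + c` on the stack `y`, where `n` is the top number of the stack `x`, which is
kept. The stack `t` is used as an auxiliary stack. -/
def lin (x y t : K) (m c : ℕ) : Prog K :=
  seq (push y) (seq (addConst y c) (seq (push t)
    (seq (loop x (seq (addConst y m) (inc t))) (move t x))))

/-- Reading a number destroys it, so the loop keeps a copy on `t`. With `j` left on `x`, the tops of
`y` and `t` are `m * (n - j) + c` and `n - j`; finally the copy moves back to `x`. -/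
theorem Runs.lin {x y t : K} (hxy : x ≠ y) (hxt : x ≠ t) (hyt : y ≠ t) (m c : ℕ)
    {s : K → List ℕ} {n : ℕ} {l : List ℕ} (h : s x = n :: l) :
    Runs (lin x y t m c) s (Function.update s y ((m * n + c) :: s y)) ((m + 5) * n + c + 6) := by
  have hloop := loop_count (k := x) (p := Prog.seq (Prog.addConst y m) (Prog.inc t)) (T := m + 2)
    (fun j => Function.update (Function.update (Function.update s x (j :: l)) y
      ((m * (n - j) + c) :: s y)) t ((n - j) :: s t)) l
    (by simp [hxy, hxt]) n (fun j hj => by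
      have h1 := addConst (k := y) m (s := Function.update (Function.update (Function.update
        (Function.update s x ((j + 1) :: l)) y ((m * (n - (j + 1)) + c) :: s y)) t
        ((n - (j + 1)) :: s t)) x (j :: l))
        (n := m * (n - (j + 1)) + c) (l := s y) (by simp [hxy.symm, hyt])
      have h2 := h1.seq (inc (k := t) (n := n - (j + 1)) (l := s t) (by
        simp [hxt.symm, hyt.symm]))
      convert h2 using 1
      obtain ⟨d, hd⟩ : ∃ d, n - j = d + 1 := ⟨n - j - 1, by omega⟩
      have hd' : n - (j + 1) = d := by omega
      simp only [hd, hd']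
      funext k
      by_cases hy : k = y
      · subst hy; simp [hyt]; ring
      · by_cases hx : k = x
        · subst hx; simp [hxy, hxt]
        · by_cases ht : k = t
          · subst ht; simp
          · simp [hx, hy, ht])
  refine Runs.mono (t := 1 + (c + 1 + (1 + ((n * (m + 2 + 1) + 1) + (2 * n + 2)))))
    ((push y s).seq ((addConst (k := y) c (n := 0) (l := s y) (by simp)).seq
    ((push t _).seq (Runs.seq (s₁ := Function.update (Function.update (Function.update s x l) y
        ((m * n + c) :: s y)) t (n :: s t)) ?_ ?_)))) (le_of_eq (by ring))
  · convert hloop using 1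
    · funext k
      by_cases hy : k = y
      · subst hy; simp [hyt]
      · by_cases hx : k = x
        · subst hx; simp [hxy, hxt, h]
        · by_cases ht : k = t
          · subst ht; simp [hyt.symm]
          · simp [hx, hy, ht]
    · funext k
      by_cases hy : k = y
      · subst hy; simp [hyt, hxy.symm]
      · by_cases hx : k = x
        · subst hx; simp [hxy, hxt]
        · by_cases ht : k = t
          · subst ht; simp [hxt.symm]
          · simp [hx, hy, ht]
  · have h2 := move (x := t) (y := x) hxt.symm (s := Function.update (Function.update
      (Function.update s x l) y ((m * n + c) :: s y)) t (n :: s t)) (n := n) (l := s t) (by simp)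
    convert h2 using 1
    funext k
    by_cases hy : k = y
    · subst hy; simp [hyt, hxy.symm]
    · by_cases hx : k = x
      · subst hx; simp [hxy, hxt, h]
      · by_cases ht : k = t
        · subst ht; simp [hxt.symm, hyt.symm]
        · simp [hx, hy, ht]

/-- Add the distance of the top numbers of the stacks `x` and `y`, which are removed, to the top
number of the stack `d`. -/
def dist (x y d : K) : Prog K :=
  seq (loop x (ifz y (seq (push y) (inc d)) skip)) (loop y (inc d))

/-- With truncated subtraction, one of `n - m` and `m - n` is zero and their sum is the distance.
The first loop decrements both numbers together and counts the excess `n - m` on `d`, leaving `m -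
n` on `y`; the second loop adds this remainder. -/
theorem Runs.dist {x y d : K} (hxy : x ≠ y) (hxd : x ≠ d) (hyd : y ≠ d)
    {s : K → List ℕ} {n m e : ℕ} {lx ly ld : List ℕ} (hx : s x = n :: lx) (hy : s y = m :: ly)
    (hd : s d = e :: ld) :
    Runs (dist x y d) s (Function.update (Function.update (Function.update s x lx) y ly) d
      ((e + (n - m) + (m - n)) :: ld)) (4 * n + 2 * m + 2) := by
  have h1 := loop_count (k := x)
    (p := Prog.ifz y (Prog.seq (Prog.push y) (Prog.inc d)) Prog.skip) (T := 3)
    (fun j => Function.update (Function.update (Function.update s x (j :: lx)) y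
      ((m - (n - j)) :: ly)) d ((e + (n - j - m)) :: ld)) lx
    (by simp [hxy, hxd]) n (fun j hj => by
      obtain ⟨i, hi⟩ : ∃ i, n - j = i + 1 := ⟨n - j - 1, by omega⟩
      have hi' : n - (j + 1) = i := by omega
      simp only [hi, hi']
      rcases Nat.lt_or_ge i m with hm | hm
      · obtain ⟨a, ha⟩ : ∃ a, m - i = a + 1 := ⟨m - i - 1, by omega⟩
        have ha' : m - (i + 1) = a := by omega
        have hz : i + 1 - m = 0 := by omega
        have hz' : i - m = 0 := by omega
        simp only [ha, ha', hz, hz']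
        refine (ifz_succ (n := a) (l := ly) (by simp [hxy.symm, hyd]) ?_).mono (t := 1 + 1)
          (by omega)
        refine (skip _).congr ?_
        funext k
        by_cases hy : k = y
        · subst hy; simp [hyd]
        · by_cases hx : k = x
          · subst hx; simp [hxy, hxd]
          · simp [hx, hy, Function.update_apply]
      · have ha : m - i = 0 := by omega
        have ha' : m - (i + 1) = 0 := by omega
        have hz : i + 1 - m = i - m + 1 := by omega
        simp only [ha, ha', hz]
        -- The test removes the `0` from `y`, so the program pushes it back before counting.
        refine (ifz_zero (l := ly) (by simp [hxy.symm, hyd]) ?_).mono (t := 2 + 1) (by omega)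
        refine ((push y _).seq (inc (n := e + (i - m)) (l := ld) (by
          simp [hxd.symm, hyd.symm]))).congr ?_
        funext k
        by_cases hy : k = y
        · subst hy; simp [hyd]
        · by_cases hx : k = x
          · subst hx; simp [hxy, hxd]
          · by_cases hd : k = d
            · subst hd; simp; omega
            · simp [hx, hy, hd])
  have h2 := loop_count (k := y) (p := Prog.inc d) (T := 1)
    (fun j => Function.update (Function.update (Function.update s x lx) y (j :: ly)) d
      ((e + (n - m) + ((m - n) - j)) :: ld)) ly (by simp [hyd]) (m - n) (fun j hj => by
      have := inc (k := d) (s := Function.update (Function.update (Function.update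
        (Function.update s x lx) y ((j + 1) :: ly)) d ((e + (n - m) + ((m - n) - (j + 1))) :: ld))
        y (j :: ly)) (n := e + (n - m) + ((m - n) - (j + 1))) (l := ld) (by simp [hyd.symm])
      convert this using 1
      funext k
      by_cases hy : k = y
      · subst hy; simp [hyd]
      · by_cases hd : k = d
        · subst hd; simp; omega
        · simp [hd, hy])
  refine (Runs.seq (t₁ := n * (3 + 1) + 1) (t₂ := (m - n) * (1 + 1) + 1) (s₁ := Function.update
    (Function.update (Function.update s x lx) y ((m - n) :: ly)) d ((e + (n - m)) :: ld))
    ?_ ?_).mono (by omega)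
  · convert h1 using 1
    · funext k
      by_cases hy : k = y
      · subst hy; simp [hyd, hy]
      · by_cases hx : k = x
        · subst hx; simp [hxy, hxd, hx]
        · by_cases hd : k = d
          · subst hd; simp [hd]
          · simp [hx, hy, hd]
    · funext k
      by_cases hy : k = y
      · subst hy; simp [hyd, hxy.symm]
      · by_cases hx : k = x
        · subst hx; simp [hxy, hxd]
        · by_cases hd : k = d
          · subst hd; simp [hxd.symm]
          · simp [hx, hy, hd]
  · convert h2 using 1
    · simp
    · funext k
      by_cases hy : k = y
      · subst hy; simp [hyd]
      · by_cases hd : k = d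
        · subst hd; simp [hyd.symm]
        · simp [hy, hd]

/-! ### Encoded lists of tuples -/

/-- A list of numbers on top of the stack `r`. -/
def encN : List ℕ → List ℕ → List ℕ
  | [], r => 0 :: r
  | p :: l, r => (p + 1) :: encN l r

/-- A list of labelled edges on top of the stack `r`. -/
def encT : List (ℕ × ℕ × ℕ) → List ℕ → List ℕ
  | [], r => 0 :: r
  | a :: l, r => (a.1 + 1) :: a.2.1 :: a.2.2 :: encT l r

/-- A list of pairs. -/
def encV : List (ℕ × ℕ) → List ℕ
  | [] => [0]
  | a :: l => (a.1 + 1) :: a.2 :: encV l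

/-- A list of pairs of pairs. -/
def encE : List ((ℕ × ℕ) × (ℕ × ℕ)) → List ℕ
  | [] => [0]
  | a :: l => (a.1.1 + 1) :: a.1.2 :: a.2.1 :: a.2.2 :: encE l

/-! ### Tables of labelled edges -/

/-- A labelled edge whose entries are affine functions of three numbers. -/
structure Row where
  /-- slope of the source -/
  m₁ : ℕ
  /-- constant term of the source -/
  c₁ : ℕ
  /-- slope of the label -/
  m₂ : ℕ
  /-- constant term of the label -/
  c₂ : ℕ
  /-- slope of the target -/
  m₃ : ℕ
  /-- constant term of the target -/
  c₃ : ℕ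

/-- The labelled edge described by a row. -/
def Row.item (w : Row) (n₁ n₂ n₃ : ℕ) : ℕ × ℕ × ℕ :=
  (w.m₁ * n₁ + w.c₁, w.m₂ * n₂ + w.c₂, w.m₃ * n₃ + w.c₃)

/-- All coefficients are at most `6`. -/
def Row.Small (w : Row) : Prop :=
  w.m₁ ≤ 6 ∧ w.c₁ ≤ 6 ∧ w.m₂ ≤ 6 ∧ w.c₂ ≤ 6 ∧ w.m₃ ≤ 6 ∧ w.c₃ ≤ 6

/-- Add the labelled edges described by `ws` to the list `M`. -/
def addItems (ws : List Row) (n₁ n₂ n₃ : ℕ) (M : List (ℕ × ℕ × ℕ)) : List (ℕ × ℕ × ℕ) :=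
  ws.foldl (fun M w => w.item n₁ n₂ n₃ :: M) M

section

variable {K : Type} [DecidableEq K]

/-- Push the labelled edge described by `w`. -/
def emit (w : Row) (d a b c t : K) : Prog K :=
  seq (lin c d t w.m₃ w.c₃) (seq (lin b d t w.m₂ w.c₂) (lin a d t w.m₁ (w.c₁ + 1)))

/-- Push the labelled edges described by `ws`. -/
def emitAll (d a b c t : K) : List Row → Prog K
  | [] => skip
  | w :: ws => seq (emit w d a b c t) (emitAll d a b c t ws)

/-- The entries are pushed in reverse order, so the source ends on top; its extra `1` is the marker
by which `encT` distinguishes an item from the end of the list. -/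
theorem Runs.emit {w : Row} (hw : w.Small) {d a b c t : K} (had : a ≠ d) (hbd : b ≠ d)
    (hcd : c ≠ d) (hat : a ≠ t) (hbt : b ≠ t) (hct : c ≠ t) (hdt : d ≠ t) {s : K → List ℕ}
    {B n₁ n₂ n₃ : ℕ} {l₁ l₂ l₃ : List ℕ} (h₁ : s a = n₁ :: l₁) (h₂ : s b = n₂ :: l₂)
    (h₃ : s c = n₃ :: l₃) (hB₁ : n₁ ≤ B) (hB₂ : n₂ ≤ B) (hB₃ : n₃ ≤ B) :
    Runs (emit w d a b c t) s
      (Function.update s d (((w.item n₁ n₂ n₃).1 + 1) :: (w.item n₁ n₂ n₃).2.1 ::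
        (w.item n₁ n₂ n₃).2.2 :: s d)) (39 * B + 39) := by
  obtain ⟨i₁, j₁, i₂, j₂, i₃, j₃⟩ := hw
  have k₁ := Nat.mul_le_mul (Nat.add_le_add_right i₁ 5) hB₁
  have k₂ := Nat.mul_le_mul (Nat.add_le_add_right i₂ 5) hB₂
  have k₃ := Nat.mul_le_mul (Nat.add_le_add_right i₃ 5) hB₃
  refine Runs.congr (Runs.mono ((lin hcd hct hdt _ _ h₃).seq
    ((lin hbd hbt hdt _ _ (l := l₂) (n := n₂) (by simp [hbd, h₂])).seq
      (lin had hat hdt _ _ (l := l₁) (n := n₁) (by simp [had, h₁])))) (by omega)) ?_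
  simp [Row.item, Nat.add_assoc]

theorem Runs.emitAll {ws : List Row} (hw : ∀ w ∈ ws, w.Small) {d a b c t : K} (had : a ≠ d)
    (hbd : b ≠ d) (hcd : c ≠ d) (hat : a ≠ t) (hbt : b ≠ t) (hct : c ≠ t) (hdt : d ≠ t)
    {s : K → List ℕ} {B n₁ n₂ n₃ : ℕ} {l₁ l₂ l₃ : List ℕ} (h₁ : s a = n₁ :: l₁)
    (h₂ : s b = n₂ :: l₂) (h₃ : s c = n₃ :: l₃) (hB₁ : n₁ ≤ B) (hB₂ : n₂ ≤ B) (hB₃ : n₃ ≤ B)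
    {M : List (ℕ × ℕ × ℕ)} {r : List ℕ} (hM : s d = encT M r) :
    Runs (emitAll d a b c t ws) s
      (Function.update s d (encT (addItems ws n₁ n₂ n₃ M) r)) (ws.length * (39 * B + 39) + 1) := by
  induction ws generalizing s M with
  | nil =>
    refine (Runs.skip s).congr ?_ |>.mono (by omega)
    rw [addItems, List.foldl_nil, ← hM, Function.update_eq_self]
  | cons w ws ih =>
    have e₁ := emit (hw w List.mem_cons_self) had hbd hcd hat hbt hct hdt h₁ h₂ h₃ hB₁ hB₂ hB₃
    rw [hM] at e₁
    have e₂ := ih (fun w h => hw w (List.mem_cons_of_mem _ h))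
      (s := Function.update s d (encT (w.item n₁ n₂ n₃ :: M) r)) (M := w.item n₁ n₂ n₃ :: M)
      (by simp [had, h₁]) (by simp [hbd, h₂]) (by simp [hcd, h₃]) (by simp)
    rw [Function.update_idem] at e₂
    refine (e₁.seq e₂).mono (le_of_eq ?_)
    simp only [List.length_cons]
    ring

end

/-! ### The registers -/

/-- The names of the stacks. -/
inductive Reg
  | inp | ga | gb | sh | ed | wl | x1 | x2 | x3 | y1 | y2 | y3 | df | au | c1 | c2 | res
  deriving DecidableEq

instance : Fintype Reg where
  elems := {.inp, .ga, .gb, .sh, .ed, .wl, .x1, .x2, .x3, .y1, .y2, .y3, .df, .au, .c1, .c2, .res}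
  complete := fun k => by cases k <;> decide

/-- The contents of the stacks. -/
@[ext] structure Regs where
  /-- the input -/
  inp : List ℕ := []
  /-- the first labelled graph -/
  ga : List ℕ := []
  /-- the second labelled graph -/
  gb : List ℕ := []
  /-- elements of a list that have been processed -/
  sh : List ℕ := []
  /-- the edges of the product graph -/
  ed : List ℕ := []
  /-- the vertices that remain to be processed -/
  wl : List ℕ := []
  /-- register -/
  x1 : List ℕ := []
  /-- register -/
  x2 : List ℕ := []
  /-- register -/
  x3 : List ℕ := []
  /-- register -/
  y1 : List ℕ := []
  /-- register -/
  y2 : List ℕ := []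
  /-- register -/
  y3 : List ℕ := []
  /-- the result of a comparison -/
  df : List ℕ := []
  /-- auxiliary stack -/
  au : List ℕ := []
  /-- first argument of a comparison -/
  c1 : List ℕ := []
  /-- second argument of a comparison -/
  c2 : List ℕ := []
  /-- the result -/
  res : List ℕ := []

/-- The contents of a stack. -/
def Regs.get (r : Regs) : Reg → List ℕ
  | .inp => r.inp | .ga => r.ga | .gb => r.gb | .sh => r.sh | .ed => r.ed | .wl => r.wl
  | .x1 => r.x1 | .x2 => r.x2 | .x3 => r.x3 | .y1 => r.y1 | .y2 => r.y2 | .y3 => r.y3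
  | .df => r.df | .au => r.au | .c1 => r.c1 | .c2 => r.c2 | .res => r.res

/-- Change the contents of a stack. -/
def Regs.set (r : Regs) (k : Reg) (l : List ℕ) : Regs :=
  match k with
  | .inp => { r with inp := l } | .ga => { r with ga := l } | .gb => { r with gb := l }
  | .sh => { r with sh := l } | .ed => { r with ed := l } | .wl => { r with wl := l }
  | .x1 => { r with x1 := l } | .x2 => { r with x2 := l } | .x3 => { r with x3 := l }
  | .y1 => { r with y1 := l } | .y2 => { r with y2 := l } | .y3 => { r with y3 := l }
  | .df => { r with df := l } | .au => { r with au := l } | .c1 => { r with c1 := l }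
  | .c2 => { r with c2 := l } | .res => { r with res := l }

/-- Replaces function updates by record updates. For concrete stack names these compute, so
consecutive configurations can be matched by `rfl`. -/
theorem Regs.update_get (r : Regs) (k : Reg) (l : List ℕ) :
    Function.update r.get k l = (r.set k l).get := by
  funext j
  cases k <;> cases j <;> rfl

section

variable {r s : Regs} {n m e : ℕ} {l : List ℕ}

/-- The program `p` changes the contents of the stacks from `r` to `s` in at most `T` steps. -/
def Leads (p : Prog Reg) (r s : Regs) (T : ℕ) : Prop := Runs p r.get s.get T

theorem Leads.mono {p : Prog Reg} {T U : ℕ} (h : Leads p r s T) (hU : T ≤ U) : Leads p r s U :=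
  Runs.mono h hU

theorem Leads.seq {p q : Prog Reg} {r₁ r₂ r₃ : Regs} {t₁ t₂ : ℕ} (h₁ : Leads p r₁ r₂ t₁)
    (h₂ : Leads q r₂ r₃ t₂) : Leads (p.seq q) r₁ r₃ (t₁ + t₂) := Runs.seq h₁ h₂

theorem Leads.push (k : Reg) (r : Regs) : Leads (push k) r (r.set k (0 :: r.get k)) 1 :=
  (Runs.push k _).congr (Regs.update_get _ _ _)

theorem Leads.inc {k : Reg} (h : r.get k = n :: l) :
    Leads (inc k) r (r.set k ((n + 1) :: l)) 1 := (Runs.inc h).congr (Regs.update_get _ _ _)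

theorem Leads.clear (k : Reg) (r : Regs) :
    Leads (clear k) r (r.set k []) ((bits (r.get k)).length + 1) :=
  (Runs.clear k _).congr (Regs.update_get _ _ _)

theorem Leads.drop {k : Reg} (h : r.get k = n :: l) :
    Leads (drop k) r (r.set k l) (2 * n + 1) := (Runs.drop h).congr (Regs.update_get _ _ _)

theorem Leads.move {x y : Reg} (h : r.get x = n :: l) (hxy : x ≠ y := by decide) :
    Leads (move x y) r ((r.set x l).set y (n :: r.get y)) (2 * n + 2) := by
  have := Runs.move hxy h
  rwa [Regs.update_get, Regs.update_get] at this

theorem Leads.lin {x y t : Reg} {m c : ℕ} (h : r.get x = n :: l) (hxy : x ≠ y := by decide)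
    (hxt : x ≠ t := by decide) (hyt : y ≠ t := by decide) :
    Leads (lin x y t m c) r (r.set y ((m * n + c) :: r.get y)) ((m + 5) * n + c + 6) :=
  (Runs.lin hxy hxt hyt m c h).congr (Regs.update_get _ _ _)

theorem Leads.dist {x y d : Reg} {lx ly ld : List ℕ} (hx : r.get x = n :: lx)
    (hy : r.get y = m :: ly) (hd : r.get d = e :: ld) (hxy : x ≠ y := by decide)
    (hxd : x ≠ d := by decide) (hyd : y ≠ d := by decide) :
    Leads (dist x y d) r (((r.set x lx).set y ly).set d ((e + (n - m) + (m - n)) :: ld))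
      (4 * n + 2 * m + 2) := by
  have := Runs.dist hxy hxd hyd hx hy hd
  rwa [Regs.update_get, Regs.update_get, Regs.update_get] at this

theorem Leads.ifz_zero {k : Reg} {p q : Prog Reg} {t : ℕ} (h : r.get k = 0 :: l)
    (hp : Leads p (r.set k l) s t) : Leads (ifz k p q) r s (t + 1) :=
  Runs.ifz_zero h (by rw [Regs.update_get]; exact hp)

theorem Leads.ifz_succ {k : Reg} {p q : Prog Reg} {t : ℕ} (h : r.get k = (n + 1) :: l)
    (hp : Leads q (r.set k (n :: l)) s t) : Leads (ifz k p q) r s (t + 1) :=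
  Runs.ifz_succ h (by rw [Regs.update_get]; exact hp)

theorem Leads.loop_zero {k : Reg} {p : Prog Reg} (h : r.get k = 0 :: l) :
    Leads (loop k p) r (r.set k l) 1 := (Runs.loop_zero h).congr (Regs.update_get _ _ _)

theorem Leads.loop_succ {k : Reg} {p : Prog Reg} {r₁ : Regs} {t₁ t₂ : ℕ}
    (h : r.get k = (n + 1) :: l) (h₁ : Leads p (r.set k (n :: l)) r₁ t₁)
    (h₂ : Leads (loop k p) r₁ s t₂) : Leads (loop k p) r s (t₁ + t₂ + 1) :=
  Runs.loop_succ h (by rw [Regs.update_get]; exact h₁) h₂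

theorem Leads.loop_foldl {α β : Type*} {k : Reg} {p : Prog Reg} {T : ℕ} (f : β → α → β)
    (F : List α → β → Regs) (G : β → Regs)
    (hz : ∀ b, ∃ r, (F [] b).get k = 0 :: r ∧ (F [] b).set k r = G b) (l : List α)
    (hs : ∀ a ∈ l, ∀ l' b, ∃ m r, (F (a :: l') b).get k = (m + 1) :: r ∧
      Leads p ((F (a :: l') b).set k (m :: r)) (F l' (f b a)) T) (b : β) :
    Leads (loop k p) (F l b) (G (l.foldl f b)) (l.length * (T + 1) + 1) :=
  Runs.loop_foldl f (fun l b => (F l b).get) (fun b => (G b).get)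
    (fun b => by
      obtain ⟨r, h1, h2⟩ := hz b
      exact ⟨r, h1, by rw [Regs.update_get, h2]⟩) l
    (fun a ha l' b => by
      obtain ⟨m, r, h1, h2⟩ := hs a ha l' b
      exact ⟨m, r, h1, by rw [Regs.update_get]; exact h2⟩) b

theorem Leads.emitAll {ws : List Row} (hw : ∀ w ∈ ws, w.Small) {d a b c t : Reg}
    {B n₁ n₂ n₃ : ℕ} {l₁ l₂ l₃ : List ℕ} (h₁ : r.get a = n₁ :: l₁)
    (h₂ : r.get b = n₂ :: l₂) (h₃ : r.get c = n₃ :: l₃) (hB₁ : n₁ ≤ B) (hB₂ : n₂ ≤ B)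
    (hB₃ : n₃ ≤ B) {M : List (ℕ × ℕ × ℕ)} (hM : r.get d = encT M l) (had : a ≠ d := by decide)
    (hbd : b ≠ d := by decide) (hcd : c ≠ d := by decide) (hat : a ≠ t := by decide)
    (hbt : b ≠ t := by decide) (hct : c ≠ t := by decide) (hdt : d ≠ t := by decide) :
    Leads (emitAll d a b c t ws) r
      (r.set d (encT (addItems ws n₁ n₂ n₃ M) l)) (ws.length * (39 * B + 39) + 1) :=
  (Runs.emitAll hw had hbd hcd hat hbt hct hdt h₁ h₂ h₃ hB₁ hB₂ hB₃ hM).congr (Regs.update_get _ _ _)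

end

open Reg

/-! ### Reading the input -/

/-- Read an automaton, and add the labelled edges described by three tables (for states, final
states, and transitions) to the stack `d`. -/
def parse (d : Reg) (m c : ℕ) (idle fin tr : List Row) : Prog Reg :=
  seq (move inp x1) <| seq (push d) <| seq (loop x1 (emitAll d x1 x1 x1 au idle)) <|
  seq (move inp x1) <| seq (lin x1 wl au m c) <| seq (drop x1) <|
  seq (loop inp (seq (move inp x1) (seq (emitAll d x1 x1 x1 au fin) (drop x1)))) <|
  loop inp (seq (move inp x1) <| seq (move inp x2) <| seq (move inp x3) <|
    seq (emitAll d x1 x2 x3 au tr) <| seq (drop x1) <| seq (drop x2) (drop x3))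

/-- Add the labelled edges for the states. -/
def idleItems (ws : List Row) : ℕ → List (ℕ × ℕ × ℕ) → List (ℕ × ℕ × ℕ)
  | 0, M => M
  | n + 1, M => idleItems ws n (addItems ws n n n M)

/-- The labelled edges produced by `parse`. -/
def parseItems (idle fin tr : List Row) (n : ℕ) (F : List ℕ) (Δ : List (ℕ × ℕ × ℕ)) :
    List (ℕ × ℕ × ℕ) :=
  Δ.foldl (fun M a => addItems tr a.1 a.2.1 a.2.2 M)
    (F.foldl (fun M f => addItems fin f f f M) (idleItems idle n []))

/-- The loop counter `x1` doubles as the argument: the test decrements before the body runs, so the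
body sees every state number from `n - 1` down to `0`. -/
theorem leads_idle {d : Reg} (hd : d = ga ∨ d = gb) {ws : List Row} (hw : ∀ w ∈ ws, w.Small)
    {B n : ℕ} (hn : n ≤ B) (i w g : List ℕ) (M : List (ℕ × ℕ × ℕ)) :
    Leads (loop x1 (emitAll d x1 x1 x1 au ws))
      (({ inp := i, wl := w, ga := g, x1 := [n] } : Regs).set d (encT M []))
      (({ inp := i, wl := w, ga := g } : Regs).set d (encT (idleItems ws n M) []))
      (n * (ws.length * (39 * B + 39) + 2) + 1) := by
  induction n generalizing M with
  | zero => rcases hd with rfl | rfl <;> refine Leads.mono (Leads.loop_zero rfl) (by omega)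
  | succ n ih =>
    rcases hd with rfl | rfl <;>
    refine Leads.mono (Leads.loop_succ (n := n) (l := []) rfl
      (Leads.emitAll hw (B := B) (l := []) rfl rfl rfl
      (by omega) (by omega) (by omega) (M := M) rfl) (ih (by omega) _)) (le_of_eq (by ring))

theorem leads_final {d : Reg} (hd : d = ga ∨ d = gb) {ws : List Row} (hw : ∀ w ∈ ws, w.Small)
    {B : ℕ} (F : List ℕ) (hF : ∀ f ∈ F, f ≤ B) (i w g : List ℕ) (M : List (ℕ × ℕ × ℕ)) :
    Leads (loop inp (seq (move inp x1) (seq (emitAll d x1 x1 x1 au ws) (drop x1))))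
      (({ inp := encN F i, wl := w, ga := g } : Regs).set d (encT M []))
      (({ inp := i, wl := w, ga := g } : Regs).set d
        (encT (F.foldl (fun M f => addItems ws f f f M) M) []))
      (F.length * (ws.length * (39 * B + 39) + 4 * B + 5) + 1) := by
  refine Leads.loop_foldl (T := ws.length * (39 * B + 39) + 4 * B + 4)
    (fun M f => addItems ws f f f M)
    (fun l M => (({ inp := encN l i, wl := w, ga := g } : Regs).set d (encT M [])))
    (fun M => (({ inp := i, wl := w, ga := g } : Regs).set d (encT M []))) ?_ F ?_ M
  · intro M
    refine ⟨i, ?_⟩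
    rcases hd with rfl | rfl <;> exact ⟨rfl, rfl⟩
  · intro f hf l M
    have := hF f hf
    refine ⟨f, encN l i, ?_⟩
    rcases hd with rfl | rfl <;>
    refine ⟨rfl, Leads.mono ((Leads.move (n := f) (l := encN l i) rfl).seq
      ((Leads.emitAll hw (B := B) (l := [])
      rfl rfl rfl this this this (M := M) rfl).seq (Leads.drop (l := []) rfl))) (by omega)⟩

theorem leads_transitions {d : Reg} (hd : d = ga ∨ d = gb) {ws : List Row}
    (hw : ∀ w ∈ ws, w.Small) {B : ℕ} (Δ : List (ℕ × ℕ × ℕ))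
    (hΔ : ∀ a ∈ Δ, a.1 ≤ B ∧ a.2.1 ≤ B ∧ a.2.2 ≤ B) (i w g : List ℕ) (M : List (ℕ × ℕ × ℕ)) :
    Leads (loop inp (seq (move inp x1) <| seq (move inp x2) <| seq (move inp x3) <|
      seq (emitAll d x1 x2 x3 au ws) <| seq (drop x1) <| seq (drop x2) (drop x3)))
      (({ inp := encT Δ i, wl := w, ga := g } : Regs).set d (encT M []))
      (({ inp := i, wl := w, ga := g } : Regs).set d
        (encT (Δ.foldl (fun M a => addItems ws a.1 a.2.1 a.2.2 M) M) []))
      (Δ.length * (ws.length * (39 * B + 39) + 12 * B + 11) + 1) := by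
  refine Leads.loop_foldl (T := ws.length * (39 * B + 39) + 12 * B + 10)
    (fun M a => addItems ws a.1 a.2.1 a.2.2 M)
    (fun l M => (({ inp := encT l i, wl := w, ga := g } : Regs).set d (encT M [])))
    (fun M => (({ inp := i, wl := w, ga := g } : Regs).set d (encT M []))) ?_ Δ ?_ M
  · intro M
    refine ⟨i, ?_⟩
    rcases hd with rfl | rfl <;> exact ⟨rfl, rfl⟩
  · intro a ha l M
    obtain ⟨h1, h2, h3⟩ := hΔ a ha
    refine ⟨a.1, a.2.1 :: a.2.2 :: encT l i, ?_⟩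
    rcases hd with rfl | rfl <;>
    refine ⟨rfl, Leads.mono ((Leads.move (n := a.1) rfl).seq <|
      (Leads.move (n := a.2.1) rfl).seq <| (Leads.move (n := a.2.2) (l := encT l i) rfl).seq <|
      (Leads.emitAll hw (B := B) (l := []) rfl rfl rfl h1 h2 h3 (M := M) rfl).seq <|
      (Leads.drop (n := a.1) (l := []) rfl).seq <| (Leads.drop (n := a.2.1) (l := []) rfl).seq
      (Leads.drop (n := a.2.2) (l := []) rfl)) (by omega)⟩

/-- Used for both automata: `g` is the first graph, already built, when `d = gb`, and `hg` makes it
empty when `d = ga`. The initial state goes to the worklist as an affine value. -/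
theorem leads_parse {d : Reg} (hd : d = ga ∨ d = gb) {m c : ℕ} (hm : m ≤ 6) (hc : c ≤ 6)
    {idle fin tr : List Row}
    (hi : ∀ w ∈ idle, w.Small) (hf : ∀ w ∈ fin, w.Small) (ht : ∀ w ∈ tr, w.Small)
    {B n q : ℕ} (hn : n ≤ B) (hq : q ≤ B) (F : List ℕ) (hF : ∀ f ∈ F, f ≤ B)
    (Δ : List (ℕ × ℕ × ℕ)) (hΔ : ∀ a ∈ Δ, a.1 ≤ B ∧ a.2.1 ≤ B ∧ a.2.2 ≤ B)
    (i w g : List ℕ) (hg : d = ga → g = []) :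
    Leads (parse d m c idle fin tr)
      { inp := n :: q :: encN F (encT Δ i), wl := w, ga := g }
      (({ inp := i, wl := (m * q + c) :: w, ga := g } : Regs).set d
        (encT (parseItems idle fin tr n F Δ) []))
      (n * (idle.length * (39 * B + 39) + 2) +
        F.length * (fin.length * (39 * B + 39) + 4 * B + 5) +
        Δ.length * (tr.length * (39 * B + 39) + 12 * B + 11) + 20 * B + 30) := by
  have h1 := leads_idle hd hi hn (q :: encN F (encT Δ i)) w g []
  have h2 := leads_final hd hf F hF (encT Δ i) ((m * q + c) :: w) g (idleItems idle n [])
  have h3 := leads_transitions hd ht Δ hΔ i ((m * q + c) :: w) g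
    (F.foldl (fun M f => addItems fin f f f M) (idleItems idle n []))
  have hm := Nat.mul_le_mul (Nat.add_le_add_right hm 5) hq
  rcases hd with rfl | rfl
  · obtain rfl := hg rfl
    refine Leads.mono (Leads.seq (Leads.move (n := n) rfl) <| (Leads.push _ _).seq <| h1.seq <|
      (Leads.move (n := q) (l := encN F (encT Δ i)) rfl).seq <| (Leads.lin (l := []) rfl).seq <|
      (Leads.drop (l := []) rfl).seq <| h2.seq h3) (by omega)
  · refine Leads.mono (Leads.seq (Leads.move (n := n) rfl) <| (Leads.push _ _).seq <| h1.seq <|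
      (Leads.move (n := q) (l := encN F (encT Δ i)) rfl).seq <| (Leads.lin (l := []) rfl).seq <|
      (Leads.drop (l := []) rfl).seq <| h2.seq h3) (by omega)

/-! ### The product graph -/

/-- Move the labelled edges on the stack `sh` back to the stack `gb`. -/
def restoreGraph : Prog Reg :=
  loop sh (seq (move sh y1) <| seq (move sh y2) <| seq (move sh y3) <|
    seq (move y3 gb) <| seq (move y2 gb) <| seq (move y1 gb) (inc gb))

/-- Compare a labelled edge with one on the stack `gb`. If the labels agree, push the edge of the
product graph. -/
def productStep : Prog Reg :=
  seq (move gb y1) <| seq (move gb y2) <| seq (move gb y3) <|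
  seq (push df) <| seq (lin x2 c1 au 1 0) <| seq (lin y2 c2 au 1 0) <| seq (dist c1 c2 df) <|
  seq (ifz df (seq (lin x3 ed au 1 0) <| seq (lin y3 ed au 1 0) <| seq (lin x1 ed au 1 0)
    (lin y1 ed au 1 1)) (drop df)) <|
  seq (move y3 sh) <| seq (move y2 sh) <| seq (move y1 sh) (inc sh)

/-- Push the edges of the product of the labelled graphs on the stacks `ga` and `gb` on the
stack `ed`. -/
def product : Prog Reg :=
  seq (push ed) <|
  loop ga (seq (move ga x1) <| seq (move ga x2) <| seq (move ga x3) <| seq (push sh) <|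
    seq (loop gb productStep) <| seq (push gb) <| seq restoreGraph <|
    seq (drop x1) <| seq (drop x2) (drop x3))

/-- The edges of the product graph that come from a labelled edge `a` and the list `N`. -/
def productRow (a : ℕ × ℕ × ℕ) (N : List (ℕ × ℕ × ℕ)) (E : List ((ℕ × ℕ) × (ℕ × ℕ))) :
    List ((ℕ × ℕ) × (ℕ × ℕ)) :=
  N.foldl (fun E b => if a.2.1 = b.2.1 then ((b.1, a.1), (b.2.2, a.2.2)) :: E else E) E

/-- The edges of the product graph. -/
def productEdges (M N : List (ℕ × ℕ × ℕ)) : List ((ℕ × ℕ) × (ℕ × ℕ)) :=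
  M.foldl (fun E a => productRow a N E) []

/-- All entries of the labelled edges are at most `B`. -/
def Bounded (B : ℕ) (M : List (ℕ × ℕ × ℕ)) : Prop := ∀ a ∈ M, a.1 ≤ B ∧ a.2.1 ≤ B ∧ a.2.2 ≤ B

theorem leads_restoreGraph {B : ℕ} {S : List (ℕ × ℕ × ℕ)} (hS : Bounded B S)
    (w g e X1 X2 X3 : List ℕ) (N : List (ℕ × ℕ × ℕ)) :
    Leads restoreGraph
      { wl := w, ga := g, gb := encT N [], ed := e, x1 := X1, x2 := X2, x3 := X3, sh := encT S [] }
      { wl := w, ga := g, gb := encT (S.foldl (fun N a => a :: N) N) [], ed := e,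
        x1 := X1, x2 := X2, x3 := X3 }
      (S.length * (12 * B + 14) + 1) := by
  refine Leads.loop_foldl (T := 12 * B + 13) (fun N a => a :: N)
    (fun S N =>
      { wl := w, ga := g, gb := encT N [], ed := e, x1 := X1, x2 := X2, x3 := X3, sh := encT S [] })
    (fun N => { wl := w, ga := g, gb := encT N [], ed := e, x1 := X1, x2 := X2, x3 := X3 }) ?_ S ?_ N
  · exact fun M => ⟨[], rfl, rfl⟩
  · intro a ha S N
    obtain ⟨h1, h2, h3⟩ := hS a ha
    refine ⟨a.1, a.2.1 :: a.2.2 :: encT S [], rfl, ?_⟩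
    refine Leads.mono ((Leads.move (n := a.1) rfl).seq <|
      (Leads.move (n := a.2.1) rfl).seq <| (Leads.move (n := a.2.2) (l := encT S []) rfl).seq <|
      (Leads.move (n := a.2.2) (l := []) rfl).seq <| (Leads.move (n := a.2.1) (l := []) rfl).seq <|
      (Leads.move (n := a.1) (l := []) rfl).seq <| Leads.inc (n := a.1) rfl) (by omega)

theorem leads_productStep {B : ℕ} {a b : ℕ × ℕ × ℕ} (ha : a.1 ≤ B ∧ a.2.1 ≤ B ∧ a.2.2 ≤ B)
    (hb : b.1 ≤ B ∧ b.2.1 ≤ B ∧ b.2.2 ≤ B) (w g : List ℕ) (N S : List (ℕ × ℕ × ℕ))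
    (E : List ((ℕ × ℕ) × (ℕ × ℕ))) :
    Leads productStep
      { wl := w, ga := g, gb := b.1 :: b.2.1 :: b.2.2 :: encT N [], ed := encE E,
        x1 := [a.1], x2 := [a.2.1], x3 := [a.2.2], sh := encT S [] }
      { wl := w, ga := g, gb := encT N [],
        ed := encE (if a.2.1 = b.2.1 then ((b.1, a.1), (b.2.2, a.2.2)) :: E else E),
        x1 := [a.1], x2 := [a.2.1], x3 := [a.2.2], sh := encT (b :: S) [] }
      (60 * B + 70) := by
  obtain ⟨h1, h2, h3⟩ := ha
  obtain ⟨k1, k2, k3⟩ := hb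
  have hif : Leads (ifz df (seq (lin x3 ed au 1 0) <| seq (lin y3 ed au 1 0) <|
      seq (lin x1 ed au 1 0) (lin y1 ed au 1 1)) (drop df))
      { wl := w, ga := g, gb := encT N [], ed := encE E, x1 := [a.1], x2 := [a.2.1], x3 := [a.2.2],
        sh := encT S [], y1 := [b.1], y2 := [b.2.1], y3 := [b.2.2],
        df := [0 + (a.2.1 - b.2.1) + (b.2.1 - a.2.1)] }
      { wl := w, ga := g, gb := encT N [],
        ed := encE (if a.2.1 = b.2.1 then ((b.1, a.1), (b.2.2, a.2.2)) :: E else E),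
        x1 := [a.1], x2 := [a.2.1], x3 := [a.2.2], sh := encT S [],
        y1 := [b.1], y2 := [b.2.1], y3 := [b.2.2] } (24 * B + 26) := by
    by_cases h : a.2.1 = b.2.1
    · rw [if_pos h]
      have h0 : 0 + (a.2.1 - b.2.1) + (b.2.1 - a.2.1) = 0 := by omega
      rw [h0]
      have e : encE (((b.1, a.1), (b.2.2, a.2.2)) :: E) = (1 * b.1 + 1) :: (1 * a.1 + 0) ::
        (1 * b.2.2 + 0) :: (1 * a.2.2 + 0) :: encE E := by simp [encE]
      rw [e]
      refine Leads.mono (Leads.ifz_zero (l := []) rfl <|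
        (Leads.lin (n := a.2.2) (l := []) rfl).seq <| (Leads.lin (n := b.2.2) (l := []) rfl).seq <|
        (Leads.lin (n := a.1) (l := []) rfl).seq (Leads.lin (n := b.1) (l := []) rfl)) (by omega)
    · rw [if_neg h]
      obtain ⟨d, hd⟩ : ∃ d, 0 + (a.2.1 - b.2.1) + (b.2.1 - a.2.1) = d + 1 :=
        ⟨(a.2.1 - b.2.1) + (b.2.1 - a.2.1) - 1, by omega⟩
      rw [hd]
      refine Leads.mono (Leads.ifz_succ (n := d) (l := []) rfl
        (Leads.drop (n := d) (l := []) rfl)) (by omega)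
  -- A copy made by `lin` has the form `1 * n + 0`, which is not definitionally `n`; it is rewritten
  -- so that the configurations match.
  have e2 : (1 * a.2.1 + 0) = a.2.1 := by omega
  have e3 : (1 * b.2.1 + 0) = b.2.1 := by omega
  have l1 := Leads.lin (x := x2) (y := c1) (t := au) (m := 1) (c := 0) (r :=
      { wl := w, ga := g, gb := encT N [], ed := encE E, x1 := [a.1], x2 := [a.2.1], x3 := [a.2.2],
        sh := encT S [], y1 := [b.1], y2 := [b.2.1], y3 := [b.2.2], df := [0] })
      (n := a.2.1) (l := []) rfl
  have l2 := Leads.lin (x := y2) (y := c2) (t := au) (m := 1) (c := 0) (r :=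
      { wl := w, ga := g, gb := encT N [], ed := encE E, x1 := [a.1], x2 := [a.2.1], x3 := [a.2.2],
        sh := encT S [], y1 := [b.1], y2 := [b.2.1], y3 := [b.2.2], df := [0], c1 := [a.2.1] })
      (n := b.2.1) (l := []) rfl
  rw [e2] at l1
  rw [e3] at l2
  refine Leads.mono ((Leads.move (n := b.1) rfl).seq <|
      (Leads.move (n := b.2.1) rfl).seq <| (Leads.move (n := b.2.2) (l := encT N []) rfl).seq <|
      (Leads.push _ _).seq <| l1.seq <| l2.seq <| (Leads.dist (n := a.2.1) (m := b.2.1) (e := 0)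
        (lx := []) (ly := []) (ld := []) rfl rfl rfl).seq <| hif.seq <|
      (Leads.move (n := b.2.2) (l := []) rfl).seq <| (Leads.move (n := b.2.1) (l := []) rfl).seq <|
      (Leads.move (n := b.1) (l := []) rfl).seq <| Leads.inc (n := b.1) rfl) (by omega)

theorem leads_productRow {B : ℕ} {a : ℕ × ℕ × ℕ} (ha : a.1 ≤ B ∧ a.2.1 ≤ B ∧ a.2.2 ≤ B)
    {N : List (ℕ × ℕ × ℕ)} (hN : Bounded B N) (w g : List ℕ) (E : List ((ℕ × ℕ) × (ℕ × ℕ))) :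
    Leads (loop gb productStep)
      { wl := w, ga := g, gb := encT N [], ed := encE E,
        x1 := [a.1], x2 := [a.2.1], x3 := [a.2.2], sh := [0] }
      { wl := w, ga := g, ed := encE (productRow a N E), x1 := [a.1], x2 := [a.2.1], x3 := [a.2.2],
        sh := encT (N.foldl (fun S b => b :: S) []) [] }
      (N.length * (60 * B + 71) + 1) := by
  have := Leads.loop_foldl (T := 60 * B + 70) (k := gb) (p := productStep)
    (fun (D : List ((ℕ × ℕ) × (ℕ × ℕ)) × List (ℕ × ℕ × ℕ)) (b : ℕ × ℕ × ℕ) =>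
      (if a.2.1 = b.2.1 then ((b.1, a.1), (b.2.2, a.2.2)) :: D.1 else D.1, b :: D.2))
    (fun N D =>
      { wl := w, ga := g, gb := encT N [], ed := encE D.1,
        x1 := [a.1], x2 := [a.2.1], x3 := [a.2.2], sh := encT D.2 [] })
    (fun D =>
      { wl := w, ga := g, ed := encE D.1,
        x1 := [a.1], x2 := [a.2.1], x3 := [a.2.2], sh := encT D.2 [] })
    (fun D => ⟨[], rfl, rfl⟩) N
    (fun b hb N D => ⟨b.1, b.2.1 :: b.2.2 :: encT N [], rfl,
      leads_productStep ha (hN b hb) w g N D.2 D.1⟩) (E, [])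
  -- The fold on pairs runs two independent folds: one collects product edges, the other shelves the
  -- edges of the second graph.
  have h : ∀ (N S : List (ℕ × ℕ × ℕ)) (E : List ((ℕ × ℕ) × (ℕ × ℕ))),
      N.foldl (fun (D : List ((ℕ × ℕ) × (ℕ × ℕ)) × List (ℕ × ℕ × ℕ)) (b : ℕ × ℕ × ℕ) =>
      (if a.2.1 = b.2.1 then ((b.1, a.1), (b.2.2, a.2.2)) :: D.1 else D.1, b :: D.2)) (E, S) =
      (productRow a N E, N.foldl (fun S b => b :: S) S) := by
    intro N
    induction N with
    | nil => intro S E; rfl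
    | cons b N ih => intro S E; simp only [List.foldl_cons, ih, productRow]
  rw [h] at this
  exact this

theorem foldl_cons_eq_reverse {α : Type*} (l m : List α) :
    l.foldl (fun S b => b :: S) m = l.reverse ++ m := by
  induction l generalizing m with
  | nil => rfl
  | cons a l ih => simp [ih]

/-- Each pass over the second graph consumes it onto `sh` in reverse order; restoring reverses it
again, so the next edge of the first graph meets the original list. -/
theorem leads_product {B : ℕ} {M N : List (ℕ × ℕ × ℕ)} (hM : Bounded B M) (hN : Bounded B N)
    (w : List ℕ) :
    Leads product { wl := w, ga := encT M [], gb := encT N [] }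
      { wl := w, gb := encT N [], ed := encE (productEdges M N) }
      (M.length * (N.length * (72 * B + 85) + 12 * B + 14) + 2) := by
  have := Leads.loop_foldl (T := N.length * (72 * B + 85) + 12 * B + 13) (k := ga)
    (p := seq (move ga x1) <| seq (move ga x2) <| seq (move ga x3) <| seq (push sh) <|
    seq (loop gb productStep) <| seq (push gb) <| seq restoreGraph <|
    seq (drop x1) <| seq (drop x2) (drop x3))
    (fun E a => productRow a N E)
    (fun M E => { wl := w, ga := encT M [], gb := encT N [], ed := encE E })
    (fun E => { wl := w, gb := encT N [], ed := encE E })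
    (fun D => ⟨[], rfl, rfl⟩) M
    (fun a ha M E => ⟨a.1, a.2.1 :: a.2.2 :: encT M [], rfl, by
      obtain ⟨h1, h2, h3⟩ := hM a ha
      have hr := leads_restoreGraph (B := B) (S := N.reverse)
        (fun a ha => hN a (List.mem_reverse.mp ha)) w (encT M []) (encE (productRow a N E))
        [a.1] [a.2.1] [a.2.2] []
      rw [foldl_cons_eq_reverse, List.reverse_reverse, List.append_nil, List.length_reverse] at hr
      have hp := leads_productRow (hM a ha) hN w (encT M []) E
      rw [foldl_cons_eq_reverse, List.append_nil] at hp
      refine Leads.mono ((Leads.move (n := a.1) rfl).seq <|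
        (Leads.move (n := a.2.1) rfl).seq <| (Leads.move (n := a.2.2) (l := encT M []) rfl).seq <|
        (Leads.push _ _).seq <| hp.seq <| (Leads.push _ _).seq <| hr.seq <|
        (Leads.drop (n := a.1) (l := []) rfl).seq <| (Leads.drop (n := a.2.1) (l := []) rfl).seq <|
        Leads.drop (n := a.2.2) (l := []) rfl) ?_
      have : N.length * (72 * B + 85) = N.length * (60 * B + 71) + N.length * (12 * B + 14) := by
        ring
      omega⟩) []
  refine Leads.mono ((Leads.push ed _).seq this) (le_of_eq ?_)
  ring
/-! ### Reachability -/

/-- Move the edges on the stack `sh` back to the stack `ed`. -/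
def restoreEdges : Prog Reg :=
  loop sh (seq (move sh y2) <| seq (move sh x2) <| seq (move sh y3) <| seq (move sh x3) <|
    seq (move x3 ed) <| seq (move y3 ed) <| seq (move x2 ed) <| seq (move y2 ed) (inc ed))

/-- Compare the source of an edge with the current vertex. In case of equality, remove the edge and
push its target on the stack `wl`. -/
def edgeStep : Prog Reg :=
  seq (move ed y2) <| seq (move ed x2) <| seq (move ed y3) <| seq (move ed x3) <|
  seq (push df) <| seq (lin y1 c1 au 1 0) <| seq (lin y2 c2 au 1 0) <| seq (dist c1 c2 df) <|
  seq (lin x1 c1 au 1 0) <| seq (lin x2 c2 au 1 0) <| seq (dist c1 c2 df) <|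
  ifz df (seq (move x3 wl) <| seq (move y3 wl) <| seq (inc wl) <| seq (drop x2) (drop y2))
    (seq (drop df) <| seq (move x3 sh) <| seq (move y3 sh) <| seq (move x2 sh) <|
      seq (move y2 sh) (inc sh))

/-- Process a vertex: increment the number on the stack `res` if its second component is `0`, and
follow the edges with this source. -/
def vertexStep : Prog Reg :=
  seq (move wl y1) <| seq (move wl x1) <| seq (lin x1 c1 au 1 0) <|
  seq (ifz c1 (inc res) (drop c1)) <| seq (push sh) <| seq (loop ed edgeStep) <|
  seq (push ed) <| seq restoreEdges <| seq (drop x1) (drop y1)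

/-- Process all vertices. -/
def reach : Prog Reg := seq (push res) (loop wl vertexStep)

/-- All entries of the edges are at most `B`. -/
def BoundedE (B : ℕ) (E : List ((ℕ × ℕ) × (ℕ × ℕ))) : Prop :=
  ∀ a ∈ E, (a.1.1 ≤ B ∧ a.1.2 ≤ B) ∧ (a.2.1 ≤ B ∧ a.2.2 ≤ B)

theorem leads_restoreEdges {B : ℕ} {S : List ((ℕ × ℕ) × (ℕ × ℕ))} (hS : BoundedE B S)
    (w g z X1 Y1 : List ℕ) (E : List ((ℕ × ℕ) × (ℕ × ℕ))) :
    Leads restoreEdges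
      { wl := w, gb := g, res := z, ed := encE E, x1 := X1, y1 := Y1, sh := encE S }
      { wl := w, gb := g, res := z, ed := encE (S.foldl (fun E a => a :: E) E), x1 := X1, y1 := Y1 }
      (S.length * (16 * B + 18) + 1) := by
  refine Leads.loop_foldl (T := 16 * B + 17) (fun E a => a :: E)
    (fun S E =>
      { wl := w, gb := g, res := z, ed := encE E, x1 := X1, y1 := Y1, sh := encE S })
    (fun E => { wl := w, gb := g, res := z, ed := encE E, x1 := X1, y1 := Y1 }) ?_ S ?_ E
  · exact fun M => ⟨[], rfl, rfl⟩
  · intro a ha S E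
    obtain ⟨⟨h1, h2⟩, h3, h4⟩ := hS a ha
    refine ⟨a.1.1, a.1.2 :: a.2.1 :: a.2.2 :: encE S, rfl, ?_⟩
    refine Leads.mono ((Leads.move (n := a.1.1) rfl).seq <|
      (Leads.move (n := a.1.2) rfl).seq <| (Leads.move (n := a.2.1) rfl).seq <|
      (Leads.move (n := a.2.2) (l := encE S) rfl).seq <|
      (Leads.move (n := a.2.2) (l := []) rfl).seq <| (Leads.move (n := a.2.1) (l := []) rfl).seq <|
      (Leads.move (n := a.1.2) (l := []) rfl).seq <|
      (Leads.move (n := a.1.1) (l := []) rfl).seq <| Leads.inc (n := a.1.1) rfl) (by omega)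

/-- Both coordinate distances accumulate on `df`, so a single zero test decides equality of the two
vertices. -/
theorem leads_edgeStep {B : ℕ} {v : ℕ × ℕ} {a : (ℕ × ℕ) × (ℕ × ℕ)} (hv : v.1 ≤ B ∧ v.2 ≤ B)
    (ha : (a.1.1 ≤ B ∧ a.1.2 ≤ B) ∧ (a.2.1 ≤ B ∧ a.2.2 ≤ B)) (g z : List ℕ)
    (W : List (ℕ × ℕ)) (E S : List ((ℕ × ℕ) × (ℕ × ℕ))) :
    Leads edgeStep
      { wl := encV W, gb := g, res := z, x1 := [v.2], y1 := [v.1], sh := encE S,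
        ed := a.1.1 :: a.1.2 :: a.2.1 :: a.2.2 :: encE E }
      { wl := encV (if a.1 = v then a.2 :: W else W), gb := g, res := z, x1 := [v.2], y1 := [v.1],
        sh := encE (if a.1 = v then S else a :: S), ed := encE E }
      (60 * B + 90) := by
  obtain ⟨h1, h2⟩ := hv
  obtain ⟨⟨k1, k2⟩, k3, k4⟩ := ha
  have hif : Leads (ifz df (seq (move x3 wl) <| seq (move y3 wl) <| seq (inc wl) <|
        seq (drop x2) (drop y2))
      (seq (drop df) <| seq (move x3 sh) <| seq (move y3 sh) <| seq (move x2 sh) <|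
        seq (move y2 sh) (inc sh)))
      { wl := encV W, gb := g, res := z, x1 := [v.2], y1 := [v.1], sh := encE S,
        y2 := [a.1.1], x2 := [a.1.2], y3 := [a.2.1], x3 := [a.2.2], ed := encE E,
        df := [0 + (v.1 - a.1.1) + (a.1.1 - v.1) + (v.2 - a.1.2) + (a.1.2 - v.2)] }
      { wl := encV (if a.1 = v then a.2 :: W else W), gb := g, res := z, x1 := [v.2], y1 := [v.1],
        sh := encE (if a.1 = v then S else a :: S), ed := encE E } (12 * B + 15) := by
    by_cases h : a.1 = v
    · rw [if_pos h, if_pos h]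
      have h0 : 0 + (v.1 - a.1.1) + (a.1.1 - v.1) + (v.2 - a.1.2) + (a.1.2 - v.2) = 0 := by
        rw [h]; omega
      rw [h0]
      refine Leads.mono (Leads.ifz_zero (l := []) rfl <|
        (Leads.move (n := a.2.2) (l := []) rfl).seq <| (Leads.move (n := a.2.1) (l := []) rfl).seq <|
        (Leads.inc (n := a.2.1) rfl).seq <| (Leads.drop (n := a.1.2) (l := []) rfl).seq <|
        Leads.drop (n := a.1.1) (l := []) rfl) (by omega)
    · rw [if_neg h, if_neg h]
      have h' : ¬ (a.1.1 = v.1 ∧ a.1.2 = v.2) := fun h' => h (Prod.ext h'.1 h'.2)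
      obtain ⟨d, hd⟩ : ∃ d, 0 + (v.1 - a.1.1) + (a.1.1 - v.1) + (v.2 - a.1.2) + (a.1.2 - v.2) =
          d + 1 := ⟨0 + (v.1 - a.1.1) + (a.1.1 - v.1) + (v.2 - a.1.2) + (a.1.2 - v.2) - 1, by omega⟩
      rw [hd]
      refine Leads.mono (Leads.ifz_succ (n := d) (l := []) rfl <|
        (Leads.drop (n := d) (l := []) rfl).seq <|
        (Leads.move (n := a.2.2) (l := []) rfl).seq <| (Leads.move (n := a.2.1) (l := []) rfl).seq <|
        (Leads.move (n := a.1.2) (l := []) rfl).seq <|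
        (Leads.move (n := a.1.1) (l := []) rfl).seq <| Leads.inc (n := a.1.1) rfl) (by omega)
  have l1 := Leads.lin (x := y1) (y := c1) (t := au) (m := 1) (c := 0) (r :=
      { wl := encV W, gb := g, res := z, x1 := [v.2], y1 := [v.1], sh := encE S,
        y2 := [a.1.1], x2 := [a.1.2], y3 := [a.2.1], x3 := [a.2.2], ed := encE E, df := [0] })
      (n := v.1) (l := []) rfl
  have l2 := Leads.lin (x := y2) (y := c2) (t := au) (m := 1) (c := 0) (r :=
      { wl := encV W, gb := g, res := z, x1 := [v.2], y1 := [v.1], sh := encE S,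
        y2 := [a.1.1], x2 := [a.1.2], y3 := [a.2.1], x3 := [a.2.2], ed := encE E, df := [0],
        c1 := [v.1] }) (n := a.1.1) (l := []) rfl
  have l3 := Leads.lin (x := x1) (y := c1) (t := au) (m := 1) (c := 0) (r :=
      { wl := encV W, gb := g, res := z, x1 := [v.2], y1 := [v.1], sh := encE S,
        y2 := [a.1.1], x2 := [a.1.2], y3 := [a.2.1], x3 := [a.2.2], ed := encE E,
        df := [0 + (v.1 - a.1.1) + (a.1.1 - v.1)] })
      (n := v.2) (l := []) rfl
  have l4 := Leads.lin (x := x2) (y := c2) (t := au) (m := 1) (c := 0) (r :=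
      { wl := encV W, gb := g, res := z, x1 := [v.2], y1 := [v.1], sh := encE S,
        y2 := [a.1.1], x2 := [a.1.2], y3 := [a.2.1], x3 := [a.2.2], ed := encE E,
        df := [0 + (v.1 - a.1.1) + (a.1.1 - v.1)], c1 := [v.2] }) (n := a.1.2) (l := []) rfl
  have e : ∀ n, 1 * n + 0 = n := fun n => by omega
  rw [e] at l1 l2 l3 l4
  refine Leads.mono ((Leads.move (n := a.1.1) rfl).seq <|
      (Leads.move (n := a.1.2) rfl).seq <| (Leads.move (n := a.2.1) rfl).seq <|
      (Leads.move (n := a.2.2) (l := encE E) rfl).seq <|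
      (Leads.push _ _).seq <| l1.seq <| l2.seq <| (Leads.dist (n := v.1) (m := a.1.1) (e := 0)
        (lx := []) (ly := []) (ld := []) rfl rfl rfl).seq <| l3.seq <| l4.seq <|
      (Leads.dist (n := v.2) (m := a.1.2) (e := 0 + (v.1 - a.1.1) + (a.1.1 - v.1))
        (lx := []) (ly := []) (ld := []) rfl rfl rfl).seq hif) (by omega)

/-- The list of vertices that remain after the vertex `v` has been processed. -/
def follow (v : ℕ × ℕ) (E : List ((ℕ × ℕ) × (ℕ × ℕ))) (W : List (ℕ × ℕ)) : List (ℕ × ℕ) :=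
  E.foldl (fun W a => if a.1 = v then a.2 :: W else W) W

theorem leads_edges {B : ℕ} {v : ℕ × ℕ} (hv : v.1 ≤ B ∧ v.2 ≤ B)
    {E : List ((ℕ × ℕ) × (ℕ × ℕ))} (hE : BoundedE B E) (g z : List ℕ) (W : List (ℕ × ℕ)) :
    Leads (loop ed edgeStep)
      { wl := encV W, gb := g, res := z, x1 := [v.2], y1 := [v.1], sh := [0], ed := encE E }
      { wl := encV (follow v E W), gb := g, res := z, x1 := [v.2], y1 := [v.1],
        sh := encE (E.filter fun a => a.1 ≠ v).reverse }
      (E.length * (60 * B + 91) + 1) := by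
  have := Leads.loop_foldl (T := 60 * B + 90) (k := ed) (p := edgeStep)
    (fun (D : List (ℕ × ℕ) × List ((ℕ × ℕ) × (ℕ × ℕ))) (a : (ℕ × ℕ) × (ℕ × ℕ)) =>
      (if a.1 = v then a.2 :: D.1 else D.1, if a.1 = v then D.2 else a :: D.2))
    (fun E D =>
      { wl := encV D.1, gb := g, res := z, x1 := [v.2], y1 := [v.1], sh := encE D.2, ed := encE E })
    (fun D => { wl := encV D.1, gb := g, res := z, x1 := [v.2], y1 := [v.1], sh := encE D.2 })
    (fun D => ⟨[], rfl, rfl⟩) E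
    (fun a ha E D => ⟨a.1.1, a.1.2 :: a.2.1 :: a.2.2 :: encE E, rfl,
      leads_edgeStep hv (hE a ha) g z D.1 E D.2⟩) (W, [])
  have h : ∀ (E S : List ((ℕ × ℕ) × (ℕ × ℕ))) (W : List (ℕ × ℕ)),
      E.foldl (fun (D : List (ℕ × ℕ) × List ((ℕ × ℕ) × (ℕ × ℕ))) (a : (ℕ × ℕ) × (ℕ × ℕ)) =>
      (if a.1 = v then a.2 :: D.1 else D.1, if a.1 = v then D.2 else a :: D.2)) (W, S) =
      (follow v E W, (E.filter fun a => a.1 ≠ v).reverse ++ S) := by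
    intro E
    induction E with
    | nil => intro S W; rfl
    | cons a E ih =>
      intro S W
      simp only [List.foldl_cons, ih, follow]
      by_cases h : a.1 = v <;> simp [h]
  rw [h, List.append_nil] at this
  exact this

/-- An edge either stays or is traded for one worklist entry. As `v` itself has left the worklist,
processing it lowers the total of vertices and edges by one: this is the termination measure. -/
theorem length_follow (v : ℕ × ℕ) (E : List ((ℕ × ℕ) × (ℕ × ℕ))) (W : List (ℕ × ℕ)) :
    (follow v E W).length + (E.filter fun a => a.1 ≠ v).length = W.length + E.length := by
  induction E generalizing W with
  | nil => rfl
  | cons a E ih =>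
    simp only [follow, List.foldl_cons] at ih ⊢
    rw [List.filter_cons]
    have := ih (if a.1 = v then a.2 :: W else W)
    by_cases h : a.1 = v <;> simp [h] at this ⊢ <;> omega

theorem mem_follow {v x : ℕ × ℕ} {E : List ((ℕ × ℕ) × (ℕ × ℕ))} {W : List (ℕ × ℕ)} :
    x ∈ follow v E W ↔ x ∈ W ∨ (v, x) ∈ E := by
  induction E generalizing W with
  | nil => simp [follow]
  | cons a E ih =>
    simp only [follow, List.foldl_cons] at ih ⊢
    rw [ih]
    obtain ⟨a, b⟩ := a
    by_cases h : a = v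
    · subst h; simp; tauto
    · simp [h, Ne.symm h]

/-- Some vertex whose second component is `0` can be reached from the list `W`. -/
def Hits (E : List ((ℕ × ℕ) × (ℕ × ℕ))) (W : List (ℕ × ℕ)) : Prop :=
  ∃ w ∈ W, ∃ x, Relation.ReflTransGen (fun a b => (a, b) ∈ E) w x ∧ x.2 = 0

/-- Cut a path at its last visit to `v`. The rest starts at a target of an edge out of `v` and never
leaves `v` again, so the edges out of `v` may be deleted once their targets are in the worklist. -/
theorem hits_cons {v : ℕ × ℕ} {E : List ((ℕ × ℕ) × (ℕ × ℕ))} {W : List (ℕ × ℕ)} :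
    Hits E (v :: W) ↔ v.2 = 0 ∨ Hits (E.filter fun a => a.1 ≠ v) (follow v E W) := by
  constructor
  · rintro ⟨w, hw, x, hx, h0⟩
    have : x = v ∨ ∃ w ∈ follow v E W,
        Relation.ReflTransGen (fun a b => (a, b) ∈ E.filter fun a => a.1 ≠ v) w x := by
      clear h0
      induction hx with
      | refl =>
        rcases List.mem_cons.mp hw with rfl | hw
        · exact Or.inl rfl
        · exact Or.inr ⟨w, mem_follow.mpr (Or.inl hw), .refl⟩
      | @tail b c _ hbc ih =>
        by_cases hb : b = v
        · subst hb
          exact Or.inr ⟨c, mem_follow.mpr (Or.inr hbc), .refl⟩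
        · obtain ⟨u, hu, hub⟩ := ih.resolve_left hb
          exact Or.inr ⟨u, hu, hub.tail (List.mem_filter.mpr ⟨hbc, by simpa using hb⟩)⟩
    rcases this with rfl | ⟨w, hw, hwx⟩
    · exact Or.inl h0
    · exact Or.inr ⟨w, hw, x, hwx, h0⟩
  · rintro (h0 | ⟨w, hw, x, hx, h0⟩)
    · exact ⟨v, List.mem_cons_self, v, .refl, h0⟩
    · have hx' : Relation.ReflTransGen (fun a b => (a, b) ∈ E) w x :=
        hx.lift id fun a b h => List.mem_of_mem_filter h
      rcases mem_follow.mp hw with hw | hw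
      · exact ⟨w, List.mem_cons_of_mem _ hw, x, hx', h0⟩
      · exact ⟨v, List.mem_cons_self, x, .head hw hx', h0⟩

/-- All entries of the pairs are at most `B`. -/
def BoundedV (B : ℕ) (W : List (ℕ × ℕ)) : Prop := ∀ w ∈ W, w.1 ≤ B ∧ w.2 ≤ B

theorem leads_vertexStep {B L : ℕ} {v : ℕ × ℕ} (hv : v.1 ≤ B ∧ v.2 ≤ B)
    {E : List ((ℕ × ℕ) × (ℕ × ℕ))} (hE : BoundedE B E) (hL : E.length ≤ L) (g : List ℕ) (z : ℕ)
    (W : List (ℕ × ℕ)) :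
    Leads vertexStep
      { wl := v.1 :: v.2 :: encV W, gb := g, res := [z], ed := encE E }
      { wl := encV (follow v E W), gb := g, res := [if v.2 = 0 then z + 1 else z],
        ed := encE (E.filter fun a => a.1 ≠ v) }
      (L * (76 * B + 109) + 16 * B + 20) := by
  obtain ⟨h1, h2⟩ := hv
  have hif : Leads (ifz c1 (inc res) (drop c1))
      { wl := encV W, gb := g, res := [z], ed := encE E, x1 := [v.2], y1 := [v.1],
        c1 := [1 * v.2 + 0] }
      { wl := encV W, gb := g, res := [if v.2 = 0 then z + 1 else z], ed := encE E, x1 := [v.2],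
        y1 := [v.1] } (2 * B + 2) := by
    obtain ⟨v1, v2⟩ := v
    cases v2 with
    | zero => refine Leads.mono (Leads.ifz_zero (l := []) rfl (Leads.inc (n := z) rfl)) (by omega)
    | succ n =>
      have e : 1 * (n + 1) + 0 = n + 1 := by omega
      simp only [e]
      refine Leads.mono (Leads.ifz_succ (n := n) (l := []) rfl (Leads.drop (n := n) rfl))
        (by simp only at h2; omega)
  have hr := leads_restoreEdges (B := B) (S := (E.filter fun a => a.1 ≠ v).reverse)
    (fun a ha => hE a (List.mem_of_mem_filter (List.mem_reverse.mp ha))) (encV (follow v E W)) g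
    [if v.2 = 0 then z + 1 else z] [v.2] [v.1] []
  rw [foldl_cons_eq_reverse, List.reverse_reverse, List.append_nil, List.length_reverse] at hr
  refine Leads.mono ((Leads.move (n := v.1) rfl).seq <|
    (Leads.move (n := v.2) (l := encV W) rfl).seq <| (Leads.lin (n := v.2) (l := []) rfl).seq <|
    hif.seq <| (Leads.push _ _).seq <| (leads_edges ⟨h1, h2⟩ hE g _ W).seq <|
    (Leads.push _ _).seq <| hr.seq <| (Leads.drop (n := v.2) (l := []) rfl).seq <|
    Leads.drop (n := v.1) (l := []) rfl) ?_
  have e1 := Nat.mul_le_mul_right (60 * B + 91) hL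
  have e2 := Nat.mul_le_mul_right (16 * B + 18) ((List.length_filter_le (fun a => a.1 ≠ v) E).trans hL)
  have e3 : L * (76 * B + 109) = L * (60 * B + 91) + L * (16 * B + 18) := by ring
  omega

/-- Induction on a bound `n` for the measure of `length_follow`. A positive counter records a hit.
The bounds on `z'` and on the leftover edges `E'` serve to estimate the cost of the final cleanup.
-/
theorem leads_vertices {B L n : ℕ} {W : List (ℕ × ℕ)} (hW : BoundedV B W)
    {E : List ((ℕ × ℕ) × (ℕ × ℕ))} (hE : BoundedE B E) (hL : E.length ≤ L)
    (hn : W.length + E.length ≤ n) (g : List ℕ) (z : ℕ) :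
    ∃ z' E', (z' = 0 ↔ z = 0 ∧ ¬ Hits E W) ∧ E' ⊆ E ∧ E'.length ≤ L ∧ z' ≤ z + n ∧
      Leads (loop wl vertexStep)
        { wl := encV W, gb := g, res := [z], ed := encE E }
        { gb := g, res := [z'], ed := encE E' }
        (n * (L * (76 * B + 109) + 16 * B + 21) + 1) := by
  induction n generalizing W E z with
  | zero =>
    have : W = [] := List.length_eq_zero_iff.mp (by omega)
    subst this
    exact ⟨z, E, by simp [Hits], List.Subset.refl E, hL, by omega,
      Leads.mono (Leads.loop_zero (l := []) rfl) (by omega)⟩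
  | succ n ih =>
    cases W with
    | nil =>
      exact ⟨z, E, by simp [Hits], List.Subset.refl E, hL, by omega,
        Leads.mono (Leads.loop_zero (l := []) rfl) (by omega)⟩
    | cons v W =>
      have hl := length_follow v E W
      simp only [List.length_cons] at hn
      have hb : BoundedV B (follow v E W) := by
        intro w hw
        rcases mem_follow.mp hw with hw | hw
        · exact hW w (List.mem_cons_of_mem _ hw)
        · exact (hE _ hw).2
      obtain ⟨z', E', h1, h2, h3, h4, h5⟩ := ih (W := follow v E W)
        (E := E.filter fun a => a.1 ≠ v) (z := if v.2 = 0 then z + 1 else z) hb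
        (fun a ha => hE a (List.mem_of_mem_filter ha))
        ((List.length_filter_le _ _).trans hL) (by omega)
      refine ⟨z', E', ?_, fun a ha => List.mem_of_mem_filter (h2 ha), h3, ?_, Leads.mono
        (Leads.loop_succ (n := v.1) rfl (leads_vertexStep (hW v List.mem_cons_self) hE hL g z W) h5)
        (le_of_eq (by ring))⟩
      · rw [h1, hits_cons]
        by_cases h0 : v.2 = 0 <;> simp [h0]
      · split at h4 <;> omega

/-! ### Membership, lengths and bounds -/

theorem mem_foldl_of_mem_iff {α β : Type*} {f : List β → α → List β} {P : α → β → Prop}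
    (hf : ∀ M a x, x ∈ f M a ↔ x ∈ M ∨ P a x) (l : List α) (M : List β) (x : β) :
    x ∈ l.foldl f M ↔ x ∈ M ∨ ∃ a ∈ l, P a x := by
  induction l generalizing M with
  | nil => simp
  | cons a l ih => simp [ih, hf, or_assoc]

theorem length_foldl_le {α β : Type*} {f : List β → α → List β} {c : ℕ}
    (hf : ∀ M a, (f M a).length ≤ M.length + c) (l : List α) (M : List β) :
    (l.foldl f M).length ≤ M.length + l.length * c := by
  induction l generalizing M with
  | nil => simp
  | cons a l ih =>
    have h1 := hf M a
    have h2 := ih (f M a)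
    simp only [List.foldl_cons, List.length_cons, Nat.succ_mul]
    omega

theorem mem_addItems {ws : List Row} {n₁ n₂ n₃ : ℕ} {M : List (ℕ × ℕ × ℕ)} {x : ℕ × ℕ × ℕ} :
    x ∈ addItems ws n₁ n₂ n₃ M ↔ x ∈ M ∨ ∃ w ∈ ws, x = w.item n₁ n₂ n₃ :=
  mem_foldl_of_mem_iff (f := fun M w => Row.item w n₁ n₂ n₃ :: M)
    (P := fun w x => x = w.item n₁ n₂ n₃)
    (fun M w x => by rw [List.mem_cons, or_comm]) ws M x

theorem length_addItems (ws : List Row) (n₁ n₂ n₃ : ℕ) (M : List (ℕ × ℕ × ℕ)) :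
    (addItems ws n₁ n₂ n₃ M).length ≤ M.length + ws.length := by
  simpa [addItems] using length_foldl_le (f := fun M w => Row.item w n₁ n₂ n₃ :: M) (c := 1)
    (fun M w => by simp) ws M

theorem mem_idleItems {ws : List Row} {n : ℕ} {M : List (ℕ × ℕ × ℕ)} {x : ℕ × ℕ × ℕ} :
    x ∈ idleItems ws n M ↔ x ∈ M ∨ ∃ p < n, ∃ w ∈ ws, x = w.item p p p := by
  induction n generalizing M with
  | zero => simp [idleItems]
  | succ n ih =>
    rw [idleItems, ih, mem_addItems]
    constructor
    · rintro ((h | h) | ⟨p, hp, h⟩)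
      · exact Or.inl h
      · exact Or.inr ⟨n, by omega, h⟩
      · exact Or.inr ⟨p, by omega, h⟩
    · rintro (h | ⟨p, hp, h⟩)
      · exact Or.inl (Or.inl h)
      · rcases Nat.lt_succ_iff_lt_or_eq.mp hp with hp | rfl
        · exact Or.inr ⟨p, hp, h⟩
        · exact Or.inl (Or.inr h)

theorem length_idleItems (ws : List Row) (n : ℕ) (M : List (ℕ × ℕ × ℕ)) :
    (idleItems ws n M).length ≤ M.length + n * ws.length := by
  induction n generalizing M with
  | zero => simp [idleItems]
  | succ n ih =>
    have h1 := length_addItems ws n n n M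
    have h2 := ih (addItems ws n n n M)
    rw [idleItems, Nat.succ_mul]
    omega

theorem mem_parseItems {idle fin tr : List Row} {n : ℕ} {F : List ℕ} {Δ : List (ℕ × ℕ × ℕ)}
    {x : ℕ × ℕ × ℕ} : x ∈ parseItems idle fin tr n F Δ ↔
      (∃ p < n, ∃ w ∈ idle, x = w.item p p p) ∨ (∃ f ∈ F, ∃ w ∈ fin, x = w.item f f f) ∨
        ∃ a ∈ Δ, ∃ w ∈ tr, x = w.item a.1 a.2.1 a.2.2 := by
  rw [parseItems, mem_foldl_of_mem_iff (P := fun a x => ∃ w ∈ tr, x = w.item a.1 a.2.1 a.2.2)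
    (fun M a x => mem_addItems), mem_foldl_of_mem_iff (P := fun f x => ∃ w ∈ fin, x = w.item f f f)
    (fun M a x => mem_addItems), mem_idleItems]
  simp [or_assoc]

theorem length_parseItems (idle fin tr : List Row) (n : ℕ) (F : List ℕ) (Δ : List (ℕ × ℕ × ℕ)) :
    (parseItems idle fin tr n F Δ).length ≤
      n * idle.length + F.length * fin.length + Δ.length * tr.length := by
  have h1 := length_idleItems idle n []
  have h2 := length_foldl_le (f := fun M f => addItems fin f f f M) (c := fin.length)
    (fun M f => length_addItems fin f f f M) F (idleItems idle n [])
  have h3 := length_foldl_le (f := fun M (a : ℕ × ℕ × ℕ) => addItems tr a.1 a.2.1 a.2.2 M)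
    (c := tr.length) (fun M a => length_addItems tr a.1 a.2.1 a.2.2 M) Δ
    (F.foldl (fun M f => addItems fin f f f M) (idleItems idle n []))
  rw [List.length_nil] at h1
  exact h3.trans (by omega)

theorem Row.Small.item_le {w : Row} (hw : w.Small) {B n₁ n₂ n₃ : ℕ} (h₁ : n₁ ≤ B) (h₂ : n₂ ≤ B)
    (h₃ : n₃ ≤ B) : (w.item n₁ n₂ n₃).1 ≤ 6 * B + 6 ∧ (w.item n₁ n₂ n₃).2.1 ≤ 6 * B + 6 ∧
      (w.item n₁ n₂ n₃).2.2 ≤ 6 * B + 6 := by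
  obtain ⟨i₁, j₁, i₂, j₂, i₃, j₃⟩ := hw
  exact ⟨Nat.add_le_add (Nat.mul_le_mul i₁ h₁) j₁, Nat.add_le_add (Nat.mul_le_mul i₂ h₂) j₂,
    Nat.add_le_add (Nat.mul_le_mul i₃ h₃) j₃⟩

theorem bounded_parseItems {idle fin tr : List Row} (hi : ∀ w ∈ idle, w.Small)
    (hf : ∀ w ∈ fin, w.Small) (ht : ∀ w ∈ tr, w.Small) {B n : ℕ} {F : List ℕ}
    {Δ : List (ℕ × ℕ × ℕ)} (hn : n ≤ B) (hF : ∀ f ∈ F, f ≤ B) (hΔ : Bounded B Δ) :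
    Bounded (6 * B + 6) (parseItems idle fin tr n F Δ) := by
  intro x hx
  rcases mem_parseItems.mp hx with ⟨p, hp, w, hw, rfl⟩ | ⟨f, hf', w, hw, rfl⟩ | ⟨a, ha, w, hw, rfl⟩
  · have : p ≤ B := by omega
    exact (hi w hw).item_le this this this
  · exact (hf w hw).item_le (hF f hf') (hF f hf') (hF f hf')
  · exact (ht w hw).item_le (hΔ a ha).1 (hΔ a ha).2.1 (hΔ a ha).2.2

theorem mem_productEdges {M N : List (ℕ × ℕ × ℕ)} {x : (ℕ × ℕ) × (ℕ × ℕ)} :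
    x ∈ productEdges M N ↔ ∃ a ∈ M, ∃ b ∈ N, a.2.1 = b.2.1 ∧ x = ((b.1, a.1), (b.2.2, a.2.2)) := by
  rw [productEdges, mem_foldl_of_mem_iff (P := fun a x => ∃ b ∈ N, a.2.1 = b.2.1 ∧
    x = ((b.1, a.1), (b.2.2, a.2.2)))]
  · simp
  · intro E a x
    exact mem_foldl_of_mem_iff (f := fun E (b : ℕ × ℕ × ℕ) =>
      if a.2.1 = b.2.1 then ((b.1, a.1), (b.2.2, a.2.2)) :: E else E)
      (P := fun b x => a.2.1 = b.2.1 ∧ x = ((b.1, a.1), (b.2.2, a.2.2)))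
      (fun M b x => by by_cases h : a.2.1 = b.2.1 <;> simp [h, or_comm]) N E x

theorem length_productEdges (M N : List (ℕ × ℕ × ℕ)) :
    (productEdges M N).length ≤ M.length * N.length := by
  have := length_foldl_le (f := fun E a => productRow a N E) (c := N.length * 1)
    (fun E a => length_foldl_le (fun M b => by split <;> simp) N E) M []
  simpa [productEdges] using this

theorem boundedE_productEdges {B : ℕ} {M N : List (ℕ × ℕ × ℕ)} (hM : Bounded B M)
    (hN : Bounded B N) : BoundedE B (productEdges M N) := by
  intro x hx
  obtain ⟨a, ha, b, hb, -, rfl⟩ := mem_productEdges.mp hx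
  exact ⟨⟨(hN b hb).1, (hM a ha).1⟩, (hN b hb).2.2, (hM a ha).2.2⟩

theorem length_bits_cons (n : ℕ) (l : List ℕ) :
    (bits (n :: l)).length = n + 1 + (bits l).length := by
  simp [bits, encNat]
  omega

theorem length_bits_encT {B : ℕ} {M : List (ℕ × ℕ × ℕ)} (hM : Bounded B M) :
    (bits (encT M [])).length ≤ M.length * (3 * B + 4) + 1 := by
  induction M with
  | nil => simp [encT, bits, encNat]
  | cons a M ih =>
    have h1 := ih fun a ha => hM a (List.mem_cons_of_mem _ ha)
    have h2 := hM a List.mem_cons_self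
    have h3 : (M.length + 1) * (3 * B + 4) = M.length * (3 * B + 4) + (3 * B + 4) := Nat.succ_mul _ _
    simp only [encT, length_bits_cons, List.length_cons, h3]
    omega

theorem length_bits_encE {B : ℕ} {E : List ((ℕ × ℕ) × (ℕ × ℕ))} (hE : BoundedE B E) :
    (bits (encE E)).length ≤ E.length * (4 * B + 5) + 1 := by
  induction E with
  | nil => simp [encE, bits, encNat]
  | cons a M ih =>
    have h1 := ih fun a ha => hE a (List.mem_cons_of_mem _ ha)
    have h2 := hE a List.mem_cons_self
    have h3 : (M.length + 1) * (4 * B + 5) = M.length * (4 * B + 5) + (4 * B + 5) := Nat.succ_mul _ _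
    simp only [encE, length_bits_cons, List.length_cons, h3]
    omega

/-! ### The decision program -/

/-- The labelled edges for a state of the first automaton: in phase `3` only the second automaton
moves. -/
def idleRowsA : List Row := [⟨6, 3, 0, 1, 6, 3⟩]

/-- The labelled edges for a final state of the first automaton. -/
def finalRowsA : List Row := [⟨6, 5, 0, 2, 0, 0⟩]

/-- The labelled edges for a transition of the first automaton: both automata move, or only the
first one moves, which happens in the phases `1` and `5`. -/
def transRowsA : List Row :=
  -- State `p` in phase `i` is the number `6 * p + i`. Labels: `0` if only the first automaton
  -- moves, `1` if only the second moves, `2` for acceptance, `a + 3` if both read the letter `a`.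
  -- As phases start at `1`, no state is numbered `0`, which is reserved for acceptance.
  [⟨6, 1, 1, 3, 6, 2⟩, ⟨6, 1, 1, 3, 6, 3⟩, ⟨6, 2, 1, 3, 6, 2⟩, ⟨6, 2, 1, 3, 6, 3⟩,
    ⟨6, 3, 1, 3, 6, 4⟩, ⟨6, 3, 1, 3, 6, 5⟩, ⟨6, 4, 1, 3, 6, 4⟩, ⟨6, 4, 1, 3, 6, 5⟩,
    ⟨6, 1, 0, 0, 6, 1⟩, ⟨6, 5, 0, 0, 6, 5⟩]

/-- The labelled edges for a state of the second automaton: only the first automaton moves. -/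
def idleRowsB : List Row := [⟨1, 0, 0, 0, 1, 0⟩]

/-- The labelled edges for a final state of the second automaton. -/
def finalRowsB : List Row := [⟨1, 0, 0, 2, 0, 0⟩]

/-- The labelled edges for a transition of the second automaton: both automata move, or only the
second one moves. -/
def transRowsB : List Row := [⟨1, 0, 1, 3, 1, 0⟩, ⟨1, 0, 0, 1, 1, 0⟩]

/-- Empty the stacks and give the answer. -/
def finish : Prog Reg :=
  seq (clear gb) <| seq (clear ed) <| ifz res (seq (push res) (inc res)) (seq (drop res) (push res))

/-- The program that decides whether a language is free with respect to another one. -/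
def decideFree : Prog Reg :=
  seq (drop inp) <| seq (push wl) <| seq (parse ga 6 1 idleRowsA finalRowsA transRowsA) <|
  seq (parse gb 1 1 idleRowsB finalRowsB transRowsB) <| seq product <| seq reach finish

theorem leads_finish {C L Z : ℕ} {N : List (ℕ × ℕ × ℕ)} (hN : Bounded C N)
    {E : List ((ℕ × ℕ) × (ℕ × ℕ))} (hE : BoundedE C E) (hL : E.length ≤ L) {z : ℕ} (hz : z ≤ Z) :
    Leads finish { gb := encT N [], ed := encE E, res := [z] }
      { res := [(decide (z = 0)).toNat] }
      (N.length * (3 * C + 4) + L * (4 * C + 5) + 2 * Z + 10) := by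
  have h1 := length_bits_encT hN
  have h2 := length_bits_encE hE
  have h3 := Nat.mul_le_mul_right (4 * C + 5) hL
  have hif : Leads (ifz res (seq (push res) (inc res)) (seq (drop res) (push res)))
      { res := [z] } { res := [(decide (z = 0)).toNat] } (2 * Z + 4) := by
    cases z with
    | zero =>
      refine Leads.mono (Leads.ifz_zero (l := []) rfl ((Leads.push _ _).seq
        (Leads.inc (n := 0) (l := []) rfl))) (by omega)
    | succ n =>
      refine Leads.mono (Leads.ifz_succ (n := n) (l := []) rfl
        ((Leads.drop (n := n) (l := []) rfl).seq (Leads.push _ _))) (by omega)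
  have c1 := Leads.clear gb { gb := encT N [], ed := encE E, res := [z] }
  have c2 := Leads.clear ed { ed := encE E, res := [z] }
  refine Leads.mono (c1.seq (c2.seq hif)) ?_
  simp only [Regs.get]
  omega

/-- A bound on the running time of `decideFree`. -/
def decideFreeTime (B C L : ℕ) : ℕ :=
  2 * (B * ((39 * B + 39) + 2) + B * ((39 * B + 39) + 4 * B + 5) +
    B * (10 * (39 * B + 39) + 12 * B + 11) + 20 * B + 30) +
  (12 * B * (4 * B * (72 * C + 85) + 12 * C + 14) + 2) +
  ((L + 1) * (L * (76 * C + 109) + 16 * C + 21) + 1) +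
  (4 * B * (3 * C + 4) + L * (4 * C + 5) + 2 * (L + 1) + 10) + 2 * B + 10

theorem decideFree_correct {B k nA qA nB qB : ℕ} {FA FB : List ℕ} {TA TB : List (ℕ × ℕ × ℕ)}
    (hk : k ≤ B) (hnA : nA ≤ B) (hqA : qA ≤ B) (hnB : nB ≤ B) (hqB : qB ≤ B)
    (hFA : ∀ f ∈ FA, f ≤ B) (hFB : ∀ f ∈ FB, f ≤ B) (hTA : Bounded B TA) (hTB : Bounded B TB)
    (lFA : FA.length ≤ B) (lFB : FB.length ≤ B) (lTA : TA.length ≤ B) (lTB : TB.length ≤ B) :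
    ∃ b : Bool, (b = true ↔ ¬ Hits (productEdges
        (parseItems idleRowsA finalRowsA transRowsA nA FA TA)
        (parseItems idleRowsB finalRowsB transRowsB nB FB TB)) [(qB, 6 * qA + 1)]) ∧
      Leads decideFree
        { inp := k :: nA :: qA :: encN FA (encT TA (nB :: qB :: encN FB (encT TB []))) }
        { res := [b.toNat] } (decideFreeTime B (6 * B + 6) (48 * B * B)) := by
  have siA : ∀ w ∈ idleRowsA, w.Small := by simp [idleRowsA, Row.Small]
  have sfA : ∀ w ∈ finalRowsA, w.Small := by simp [finalRowsA, Row.Small]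
  have stA : ∀ w ∈ transRowsA, w.Small := by simp [transRowsA, Row.Small]
  have siB : ∀ w ∈ idleRowsB, w.Small := by simp [idleRowsB, Row.Small]
  have sfB : ∀ w ∈ finalRowsB, w.Small := by simp [finalRowsB, Row.Small]
  have stB : ∀ w ∈ transRowsB, w.Small := by simp [transRowsB, Row.Small]
  set M := parseItems idleRowsA finalRowsA transRowsA nA FA TA with hMdef
  set N := parseItems idleRowsB finalRowsB transRowsB nB FB TB with hNdef
  have bM : Bounded (6 * B + 6) M := bounded_parseItems siA sfA stA hnA hFA hTA
  have bN : Bounded (6 * B + 6) N := bounded_parseItems siB sfB stB hnB hFB hTB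
  -- Twelve rows in all: one per state, one per final state, ten per transition. The second
  -- automaton has `1 + 1 + 2` rows, whence `4 * B` and at most `48 * B * B` product edges.
  have lM : M.length ≤ 12 * B := by
    have := length_parseItems idleRowsA finalRowsA transRowsA nA FA TA
    simp only [idleRowsA, finalRowsA, transRowsA, List.length_cons, List.length_nil] at this
    simp only [hMdef, idleRowsA, finalRowsA, transRowsA]
    omega
  have lN : N.length ≤ 4 * B := by
    have := length_parseItems idleRowsB finalRowsB transRowsB nB FB TB
    simp only [idleRowsB, finalRowsB, transRowsB, List.length_cons, List.length_nil] at this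
    simp only [hNdef, idleRowsB, finalRowsB, transRowsB]
    omega
  have bE := boundedE_productEdges bM bN
  have lE : (productEdges M N).length ≤ 48 * B * B :=
    (length_productEdges M N).trans ((Nat.mul_le_mul lM lN).trans (le_of_eq (by ring)))
  set C := 6 * B + 6 with hC
  set L := 48 * B * B with hL
  have bW : BoundedV C [(qB, 6 * qA + 1)] := by
    intro w hw
    rw [List.mem_singleton] at hw
    subst hw
    simp only
    omega
  obtain ⟨z, E', hz, hE', lE', hzle, hreach⟩ := leads_vertices (n := L + 1) bW bE lE
    (by simp; omega) (encT N []) 0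
  refine ⟨decide (z = 0), by simp [hz], ?_⟩
  have hfin := leads_finish bN (fun a ha => bE a (hE' ha)) lE' (Z := L + 1) (by omega : z ≤ L + 1)
  -- The constant `1` has two roles: for the first automaton it is the initial phase, for the second
  -- it is the item marker of `encV`. With the `0` pushed earlier as list end, the worklist holds
  -- exactly the start vertex.
  have hpA := leads_parse (Or.inl rfl : ga = ga ∨ ga = gb) (m := 6) (c := 1) (by omega) (by omega)
    siA sfA stA hnA hqA FA hFA TA hTA (nB :: qB :: encN FB (encT TB [])) [0] [] (fun _ => rfl)
  have hpB := leads_parse (Or.inr rfl : gb = ga ∨ gb = gb) (m := 1) (c := 1) (by omega) (by omega)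
    siB sfB stB hnB hqB FB hFB TB hTB [] [6 * qA + 1, 0] (encT M []) (fun h => by cases h)
  have hprod := leads_product bM bN (encV [(qB, 6 * qA + 1)])
  have e : 1 * qB + 1 = qB + 1 := by omega
  rw [e] at hpB
  refine Leads.mono ((Leads.drop (n := k) rfl).seq <| (Leads.push _ _).seq <| hpA.seq <|
    hpB.seq <| hprod.seq <| ((Leads.push _ _).seq hreach).seq hfin) ?_
  have t1 : nA * (idleRowsA.length * (39 * B + 39) + 2) +
      FA.length * (finalRowsA.length * (39 * B + 39) + 4 * B + 5) +
      TA.length * (transRowsA.length * (39 * B + 39) + 12 * B + 11) ≤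
      B * ((39 * B + 39) + 2) + B * ((39 * B + 39) + 4 * B + 5) +
      B * (10 * (39 * B + 39) + 12 * B + 11) := by
    simp only [idleRowsA, finalRowsA, transRowsA, List.length_cons, List.length_nil]
    gcongr <;> omega
  have t2 : nB * (idleRowsB.length * (39 * B + 39) + 2) +
      FB.length * (finalRowsB.length * (39 * B + 39) + 4 * B + 5) +
      TB.length * (transRowsB.length * (39 * B + 39) + 12 * B + 11) ≤
      B * ((39 * B + 39) + 2) + B * ((39 * B + 39) + 4 * B + 5) +
      B * (10 * (39 * B + 39) + 12 * B + 11) := by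
    simp only [idleRowsB, finalRowsB, transRowsB, List.length_cons, List.length_nil]
    gcongr <;> omega
  have t3 : M.length * (N.length * (72 * C + 85) + 12 * C + 14) ≤
      12 * B * (4 * B * (72 * C + 85) + 12 * C + 14) := by gcongr
  have t4 : N.length * (3 * C + 4) ≤ 4 * B * (3 * C + 4) := by gcongr
  unfold decideFreeTime
  omega

end Prog

open Prog

/-! ### The encoding as a list of numbers -/

/-- The final states. -/
def FinNFA.finals {k : ℕ} (A : FinNFA k) : List ℕ :=
  ((List.finRange A.n).filter fun q => q ∈ A.F).map fun q : Fin A.n => (q : ℕ)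

/-- The transitions. -/
def FinNFA.triples {k : ℕ} (A : FinNFA k) : List (ℕ × ℕ × ℕ) :=
  A.transitions.map fun t => ((t.1 : ℕ), (t.2.1 : ℕ), (t.2.2 : ℕ))

/-- The numbers in the encoding of an automaton, on top of the stack `r`. -/
def FinNFA.nums {k : ℕ} (A : FinNFA k) (r : List ℕ) : List ℕ :=
  A.n :: A.q₀ :: encN A.finals (encT A.triples r)

/-- The numbers in the encoding of an instance. -/
def NFAPair.nums (I : NFAPair) : List ℕ := I.k :: I.A.nums (I.B.nums [])

/-- The marker `1` before an item merges with the unary code `1ᵐ0` into the code of `m + 1`, and the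
closing `0` is the code of the number `0`. The tail `r` lets consecutive parts of the input be
chained. -/
theorem encList_append_bits_encN {α : Type*} (f : α → ℕ) (l : List α) (r : List ℕ) :
    encList (l.map fun q => encNat (f q)) ++ bits r = bits (encN (l.map f) r) := by
  induction l with
  | nil => rfl
  | cons a l ih => simp [encList, encN, bits_succ_cons, bits_cons, ← ih]

theorem encList_append_bits_encT {α : Type*} (f g h : α → ℕ) (l : List α) (r : List ℕ) :
    encList (l.map fun t => encNat (f t) ++ encNat (g t) ++ encNat (h t)) ++ bits r =
      bits (encT (l.map fun t => (f t, g t, h t)) r) := by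
  induction l with
  | nil => rfl
  | cons a l ih => simp [encList, encT, bits_succ_cons, bits_cons, ← ih]

theorem FinNFA.enc_append_bits {k : ℕ} (A : FinNFA k) (r : List ℕ) :
    A.enc ++ bits r = bits (A.nums r) := by
  rw [FinNFA.nums, bits_cons, bits_cons, FinNFA.finals, ← encList_append_bits_encN,
    FinNFA.triples, ← encList_append_bits_encT, FinNFA.enc]
  simp

theorem NFAPair.enc_eq_bits (I : NFAPair) : I.enc = bits I.nums := by
  rw [NFAPair.nums, bits_cons, ← FinNFA.enc_append_bits, ← FinNFA.enc_append_bits, NFAPair.enc]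
  simp [bits]

/-! ### Size of an instance compared with the length of its encoding. -/

theorem length_encN (F r : List ℕ) : (encN F r).length = F.length + 1 + r.length := by
  induction F with
  | nil => simp [encN]; omega
  | cons a F ih => simp [encN, ih]; omega

theorem length_encT (T : List (ℕ × ℕ × ℕ)) (r : List ℕ) :
    (encT T r).length = 3 * T.length + 1 + r.length := by
  induction T with
  | nil => simp [encT]; omega
  | cons a T ih => simp [encT, ih]; omega

theorem length_le_length_bits (l : List ℕ) : l.length ≤ (bits l).length := by
  induction l with
  | nil => simp
  | cons a l ih => rw [length_bits_cons, List.length_cons]; omega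

theorem le_length_bits {n : ℕ} {l : List ℕ} (h : n ∈ l) : n ≤ (bits l).length := by
  induction l with
  | nil => simp at h
  | cons a l ih =>
    rw [length_bits_cons]
    rcases List.mem_cons.mp h with rfl | h
    · omega
    · have := ih h
      omega

theorem subset_encN (F r : List ℕ) : r ⊆ encN F r := by
  induction F with
  | nil => exact List.subset_cons_self _ _
  | cons a F ih => exact List.subset_cons_of_subset _ ih

theorem subset_encT (T : List (ℕ × ℕ × ℕ)) (r : List ℕ) : r ⊆ encT T r := by
  induction T with
  | nil => exact List.subset_cons_self _ _
  | cons a F ih =>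
    exact List.subset_cons_of_subset _ (List.subset_cons_of_subset _
      (List.subset_cons_of_subset _ ih))

theorem FinNFA.subset_nums {k : ℕ} (A : FinNFA k) (r : List ℕ) : r ⊆ A.nums r :=
  List.subset_cons_of_subset _ (List.subset_cons_of_subset _
    (List.Subset.trans (subset_encT _ _) (subset_encN _ _)))

theorem FinNFA.mem_finals {k : ℕ} {A : FinNFA k} {f : ℕ} :
    f ∈ A.finals ↔ ∃ q ∈ A.F, f = (q : ℕ) := by
  simp [FinNFA.finals, eq_comm]

theorem FinNFA.mem_triples {k : ℕ} {A : FinNFA k} {t : ℕ × ℕ × ℕ} :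
    t ∈ A.triples ↔ ∃ (p q : Fin A.n) (a : Fin k), q ∈ A.δ p a ∧ t = ((p : ℕ), (a : ℕ), (q : ℕ)) := by
  simp only [FinNFA.triples, FinNFA.transitions, List.mem_map, List.mem_flatMap, List.mem_filter,
    List.mem_finRange, true_and, decide_eq_true_eq]
  constructor
  · rintro ⟨_, ⟨p, a, q, hq, rfl⟩, rfl⟩
    exact ⟨p, q, a, hq, rfl⟩
  · rintro ⟨p, q, a, hq, rfl⟩
    exact ⟨_, ⟨p, a, q, hq, rfl⟩, rfl⟩

/-! ### The product graph of an instance -/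

/-- There is a path from `p` to `q` with label `w`. -/
def FinNFA.Reads {k : ℕ} (A : FinNFA k) (p : Fin A.n) (w : List (Fin k)) (q : Fin A.n) : Prop :=
  q ∈ A.toNFA.evalFrom {p} w

section

variable {k : ℕ} {A : FinNFA k}

theorem FinNFA.reads_nil {p q : Fin A.n} : A.Reads p [] q ↔ q = p := by
  simp [FinNFA.Reads]

theorem FinNFA.reads_append {p q : Fin A.n} {x y : List (Fin k)} :
    A.Reads p (x ++ y) q ↔ ∃ s, A.Reads p x s ∧ A.Reads s y q := by
  rw [FinNFA.Reads, NFA.evalFrom_append, NFA.mem_evalFrom_iff_exists]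
  rfl

theorem FinNFA.reads_singleton {p q : Fin A.n} {a : Fin k} : A.Reads p [a] q ↔ q ∈ A.δ p a := by
  simp [FinNFA.Reads, FinNFA.toNFA]

theorem FinNFA.reads_cons {p q : Fin A.n} {a : Fin k} {w : List (Fin k)} :
    A.Reads p (a :: w) q ↔ ∃ s ∈ A.δ p a, A.Reads s w q := by
  rw [← List.singleton_append, FinNFA.reads_append]
  simp only [FinNFA.reads_singleton]

theorem FinNFA.mem_lang {w : List (Fin k)} : w ∈ A.lang ↔ ∃ f ∈ A.F, A.Reads A.q₀ w f := by
  rw [FinNFA.lang, NFA.mem_accepts]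
  rfl

end

/-- The list of the changes of phases when both automata move. -/
def phases : List (ℕ × ℕ) := [(1, 2), (1, 3), (2, 2), (2, 3), (3, 4), (3, 5), (4, 4), (4, 5)]

namespace NFAPair

variable (I : NFAPair)

/-- The edges of the product graph. -/
def edges : List ((ℕ × ℕ) × (ℕ × ℕ)) :=
  productEdges (parseItems idleRowsA finalRowsA transRowsA I.A.n I.A.finals I.A.triples)
    (parseItems idleRowsB finalRowsB transRowsB I.B.n I.B.finals I.B.triples)

/-- The number pair of a vertex of the product graph. -/
def vertex (i : ℕ) (p : Fin I.A.n) (r : Fin I.B.n) : ℕ × ℕ := (r, 6 * p + i)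

variable {I}

theorem mem_edges_insert {p : Fin I.A.n} {r r' : Fin I.B.n} {b : Fin I.k} (h : r' ∈ I.B.δ r b) :
    (I.vertex 3 p r, I.vertex 3 p r') ∈ I.edges := by
  refine mem_productEdges.mpr ⟨(6 * p + 3, 1, 6 * p + 3), mem_parseItems.mpr (Or.inl
    ⟨p, p.2, _, List.mem_cons_self, by simp [Row.item]⟩), (r, 1, r'), mem_parseItems.mpr
    (Or.inr (Or.inr ⟨_, FinNFA.mem_triples.mpr ⟨r, r', b, h, rfl⟩, ⟨1, 0, 0, 1, 1, 0⟩,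
      by simp [transRowsB], by simp [Row.item]⟩)), rfl, rfl⟩

theorem mem_edges_accept {f : Fin I.A.n} {g : Fin I.B.n} (hf : f ∈ I.A.F) (hg : g ∈ I.B.F) :
    (I.vertex 5 f g, (0, 0)) ∈ I.edges := by
  refine mem_productEdges.mpr ⟨(6 * f + 5, 2, 0), mem_parseItems.mpr (Or.inr (Or.inl
    ⟨f, FinNFA.mem_finals.mpr ⟨f, hf, rfl⟩, _, List.mem_cons_self, by simp [Row.item]⟩)),
    (g, 2, 0), mem_parseItems.mpr (Or.inr (Or.inl ⟨g, FinNFA.mem_finals.mpr ⟨g, hg, rfl⟩, _,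
      List.mem_cons_self, by simp [Row.item]⟩)), rfl, rfl⟩

theorem mem_edges_left {i : ℕ} (hi : i = 1 ∨ i = 5) {p p' : Fin I.A.n} {a : Fin I.k}
    (h : p' ∈ I.A.δ p a) (r : Fin I.B.n) : (I.vertex i p r, I.vertex i p' r) ∈ I.edges := by
  refine mem_productEdges.mpr ⟨(6 * p + i, 0, 6 * p' + i), mem_parseItems.mpr (Or.inr (Or.inr
    ⟨_, FinNFA.mem_triples.mpr ⟨p, p', a, h, rfl⟩, ⟨6, i, 0, 0, 6, i⟩, ?_, by simp [Row.item]⟩)),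
    (r, 0, r), mem_parseItems.mpr (Or.inl ⟨r, r.2, _, List.mem_cons_self, by simp [Row.item]⟩),
    rfl, rfl⟩
  rcases hi with rfl | rfl <;> simp [transRowsA]

theorem mem_edges_both {i j : ℕ} (hij : (i, j) ∈ phases) {p p' : Fin I.A.n} {r r' : Fin I.B.n}
    {a : Fin I.k} (h : p' ∈ I.A.δ p a) (h' : r' ∈ I.B.δ r a) :
    (I.vertex i p r, I.vertex j p' r') ∈ I.edges := by
  refine mem_productEdges.mpr ⟨(6 * p + i, a + 3, 6 * p' + j), mem_parseItems.mpr (Or.inr (Or.inr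
    ⟨_, FinNFA.mem_triples.mpr ⟨p, p', a, h, rfl⟩, ⟨6, i, 1, 3, 6, j⟩, ?_, by simp [Row.item]⟩)),
    (r, a + 3, r'), mem_parseItems.mpr (Or.inr (Or.inr
      ⟨_, FinNFA.mem_triples.mpr ⟨r, r', a, h', rfl⟩, ⟨1, 0, 1, 3, 1, 0⟩, by simp [transRowsB],
      by simp [Row.item]⟩)), rfl, rfl⟩
  simp only [phases, List.mem_cons, Prod.mk.injEq, List.not_mem_nil, or_false] at hij
  rcases hij with h | h | h | h | h | h | h | h <;> obtain ⟨rfl, rfl⟩ := h <;> simp [transRowsA]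

/-- The labels `0`, `1`, `2` and `a + 3` are disjoint, so rows for different kinds of moves never
match; the surviving combinations are the four intended ones. -/
theorem of_mem_edges {v w : ℕ × ℕ} (h : (v, w) ∈ I.edges) :
    (∃ p r r', ∃ b, r' ∈ I.B.δ r b ∧ v = I.vertex 3 p r ∧ w = I.vertex 3 p r') ∨
    (∃ f ∈ I.A.F, ∃ g ∈ I.B.F, v = I.vertex 5 f g ∧ w = (0, 0)) ∨
    (∃ i, (i = 1 ∨ i = 5) ∧ ∃ p p' a r, p' ∈ I.A.δ p a ∧ v = I.vertex i p r ∧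
      w = I.vertex i p' r) ∨
    ∃ i j, (i, j) ∈ phases ∧ ∃ p p' r r' a, p' ∈ I.A.δ p a ∧ r' ∈ I.B.δ r a ∧
      v = I.vertex i p r ∧ w = I.vertex j p' r' := by
  obtain ⟨x, hx, y, hy, hxy, he⟩ := mem_productEdges.mp h
  obtain ⟨rfl, rfl⟩ := Prod.mk.inj he
  clear he h
  rcases mem_parseItems.mp hx with ⟨p, hp, w, hw, rfl⟩ | ⟨f, hf, w, hw, rfl⟩ | ⟨t, ht, w, hw, rfl⟩
  · obtain rfl : w = _ := List.mem_singleton.mp hw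
    rcases mem_parseItems.mp hy with ⟨r, hr, w, hw, rfl⟩ | ⟨g, hg, w, hw, rfl⟩ | ⟨t, ht, w, hw, rfl⟩
    · obtain rfl : w = _ := List.mem_singleton.mp hw
      simp [Row.item] at hxy
    · obtain rfl : w = _ := List.mem_singleton.mp hw
      simp [Row.item] at hxy
    · obtain ⟨r, r', b, hb, rfl⟩ := FinNFA.mem_triples.mp ht
      simp only [transRowsB, List.mem_cons, List.not_mem_nil, or_false] at hw
      rcases hw with rfl | rfl
      · simp [Row.item] at hxy
      · exact Or.inl ⟨⟨p, hp⟩, r, r', b, hb, by simp [Row.item, vertex], by simp [Row.item, vertex]⟩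
  · obtain rfl : w = _ := List.mem_singleton.mp hw
    obtain ⟨f, hfA, rfl⟩ := FinNFA.mem_finals.mp hf
    rcases mem_parseItems.mp hy with ⟨r, hr, w, hw, rfl⟩ | ⟨g, hg, w, hw, rfl⟩ | ⟨t, ht, w, hw, rfl⟩
    · obtain rfl : w = _ := List.mem_singleton.mp hw
      simp [Row.item] at hxy
    · obtain rfl : w = _ := List.mem_singleton.mp hw
      obtain ⟨g, hgB, rfl⟩ := FinNFA.mem_finals.mp hg
      exact Or.inr (Or.inl ⟨f, hfA, g, hgB, by simp [Row.item, vertex], by simp [Row.item]⟩)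
    · simp only [transRowsB, List.mem_cons, List.not_mem_nil, or_false] at hw
      rcases hw with rfl | rfl <;> simp [Row.item] at hxy
  · obtain ⟨p, p', a, ha, rfl⟩ := FinNFA.mem_triples.mp ht
    have hw' : (∃ i, (i = 1 ∨ i = 5) ∧ w = ⟨6, i, 0, 0, 6, i⟩) ∨
        ∃ i j, (i, j) ∈ phases ∧ w = ⟨6, i, 1, 3, 6, j⟩ := by
      simp only [transRowsA, List.mem_cons, List.not_mem_nil, or_false] at hw
      rcases hw with rfl | rfl | rfl | rfl | rfl | rfl | rfl | rfl | rfl | rfl <;> simp [phases]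
    rcases hw' with ⟨i, hi, rfl⟩ | ⟨i, j, hij, rfl⟩
    · rcases mem_parseItems.mp hy with
        ⟨r, hr, w, hw, rfl⟩ | ⟨g, hg, w, hw, rfl⟩ | ⟨t, ht, w, hw, rfl⟩
      · obtain rfl : w = _ := List.mem_singleton.mp hw
        exact Or.inr (Or.inr (Or.inl ⟨i, hi, p, p', a, ⟨r, hr⟩, ha, by simp [Row.item, vertex],
          by simp [Row.item, vertex]⟩))
      · obtain rfl : w = _ := List.mem_singleton.mp hw
        simp [Row.item] at hxy
      · simp only [transRowsB, List.mem_cons, List.not_mem_nil, or_false] at hw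
        rcases hw with rfl | rfl <;> simp [Row.item] at hxy
    · rcases mem_parseItems.mp hy with
        ⟨r, hr, w, hw, rfl⟩ | ⟨g, hg, w, hw, rfl⟩ | ⟨t, ht, w, hw, rfl⟩
      · obtain rfl : w = _ := List.mem_singleton.mp hw
        simp [Row.item] at hxy
      · obtain rfl : w = _ := List.mem_singleton.mp hw
        simp [Row.item] at hxy
      · obtain ⟨r, r', b, hb, rfl⟩ := FinNFA.mem_triples.mp ht
        simp only [transRowsB, List.mem_cons, List.not_mem_nil, or_false] at hw
        rcases hw with rfl | rfl
        · have hab : a = b := Fin.ext (by simpa [Row.item] using hxy)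
          subst hab
          exact Or.inr (Or.inr (Or.inr ⟨i, j, hij, p, p', r, r', a, ha, hb,
            by simp [Row.item, vertex], by simp [Row.item, vertex]⟩))
        · simp [Row.item] at hxy

/-- State and phase are quotient and remainder modulo `6`. -/
theorem vertex_inj {i j : ℕ} (hi : i ≤ 5) (hj : j ≤ 5) {p p' : Fin I.A.n} {r r' : Fin I.B.n}
    (h : I.vertex i p r = I.vertex j p' r') : i = j ∧ p = p' ∧ r = r' := by
  obtain ⟨h1, h2⟩ := Prod.mk.inj h
  exact ⟨by omega, Fin.ext (by omega), Fin.ext h1⟩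

variable (I) in
/-- There are words that show that the language of `I.A` is not free with respect to the language
of `I.B`. -/
def Witness : Prop :=
  ∃ x u z v y, u ≠ [] ∧ v ≠ [] ∧ x ++ u ++ v ++ y ∈ I.A.lang ∧ u ++ z ++ v ∈ I.B.lang

variable (I) in
/-- The words that lead to a vertex of the product graph. -/
def Phase : ℕ → Fin I.A.n → Fin I.B.n → Prop
  | 1, p, r => r = I.B.q₀ ∧ ∃ x, I.A.Reads I.A.q₀ x p
  | 2, p, r => ∃ x u, u ≠ [] ∧ I.A.Reads I.A.q₀ (x ++ u) p ∧ I.B.Reads I.B.q₀ u r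
  | 3, p, r => ∃ x u z, u ≠ [] ∧ I.A.Reads I.A.q₀ (x ++ u) p ∧ I.B.Reads I.B.q₀ (u ++ z) r
  | 4, p, r => ∃ x u z v, u ≠ [] ∧ v ≠ [] ∧ I.A.Reads I.A.q₀ (x ++ u ++ v) p ∧
      I.B.Reads I.B.q₀ (u ++ z ++ v) r
  | 5, p, r => ∃ x u z v y, u ≠ [] ∧ v ≠ [] ∧ I.A.Reads I.A.q₀ (x ++ u ++ v ++ y) p ∧
      I.B.Reads I.B.q₀ (u ++ z ++ v) r
  | _, _, _ => False

theorem Phase.le {i : ℕ} {p : Fin I.A.n} {r : Fin I.B.n} (h : I.Phase i p r) : i ≤ 5 := by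
  match i, h with
  | 1, _ | 2, _ | 3, _ | 4, _ | 5, _ => omega

theorem Phase.insert {p : Fin I.A.n} {r r' : Fin I.B.n} {b : Fin I.k} (h : r' ∈ I.B.δ r b)
    (hp : I.Phase 3 p r) : I.Phase 3 p r' := by
  obtain ⟨x, u, z, hu, hA, hB⟩ := hp
  refine ⟨x, u, z ++ [b], hu, hA, ?_⟩
  rw [← List.append_assoc, FinNFA.reads_append]
  exact ⟨r, hB, FinNFA.reads_singleton.mpr h⟩

theorem Phase.left {i : ℕ} (hi : i = 1 ∨ i = 5) {p p' : Fin I.A.n} {r : Fin I.B.n} {a : Fin I.k}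
    (h : p' ∈ I.A.δ p a) (hp : I.Phase i p r) : I.Phase i p' r := by
  rcases hi with rfl | rfl
  · obtain ⟨rfl, x, hx⟩ := hp
    exact ⟨rfl, x ++ [a], FinNFA.reads_append.mpr ⟨p, hx, FinNFA.reads_singleton.mpr h⟩⟩
  · obtain ⟨x, u, z, v, y, hu, hv, hA, hB⟩ := hp
    refine ⟨x, u, z, v, y ++ [a], hu, hv, ?_, hB⟩
    rw [← List.append_assoc, FinNFA.reads_append]
    exact ⟨p, hA, FinNFA.reads_singleton.mpr h⟩

theorem Phase.both {i j : ℕ} (hij : (i, j) ∈ phases) {p p' : Fin I.A.n} {r r' : Fin I.B.n}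
    {a : Fin I.k} (h : p' ∈ I.A.δ p a) (h' : r' ∈ I.B.δ r a) (hp : I.Phase i p r) :
    I.Phase j p' r' := by
  have hA : ∀ {w}, I.A.Reads I.A.q₀ w p → I.A.Reads I.A.q₀ (w ++ [a]) p' := fun hw =>
    FinNFA.reads_append.mpr ⟨p, hw, FinNFA.reads_singleton.mpr h⟩
  have hB : ∀ {w}, I.B.Reads I.B.q₀ w r → I.B.Reads I.B.q₀ (w ++ [a]) r' := fun hw =>
    FinNFA.reads_append.mpr ⟨r, hw, FinNFA.reads_singleton.mpr h'⟩
  have h2 : (i = 1 ∨ i = 2) → I.Phase 2 p' r' := by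
    rintro (rfl | rfl)
    · obtain ⟨rfl, x, hx⟩ := hp
      exact ⟨x, [a], by simp, hA hx, by simpa using hB (FinNFA.reads_nil.mpr rfl)⟩
    · obtain ⟨x, u, hu, hx, hy⟩ := hp
      exact ⟨x, u ++ [a], by simp, by simpa using hA hx, hB hy⟩
  -- Entering phase 3 means that `u` has just been completed and `z` is still empty; `h45` is the
  -- analogue for `v` and the remaining word.
  have h23 : I.Phase 2 p' r' → I.Phase 3 p' r' := fun ⟨x, u, hu, hx, hy⟩ =>
    ⟨x, u, [], hu, hx, by simpa using hy⟩
  have h4 : (i = 3 ∨ i = 4) → I.Phase 4 p' r' := by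
    rintro (rfl | rfl)
    · obtain ⟨x, u, z, hu, hx, hy⟩ := hp
      exact ⟨x, u, z, [a], hu, by simp, hA hx, hB hy⟩
    · obtain ⟨x, u, z, v, hu, hv, hx, hy⟩ := hp
      exact ⟨x, u, z, v ++ [a], hu, by simp, by simpa using hA hx, by simpa using hB hy⟩
  have h45 : I.Phase 4 p' r' → I.Phase 5 p' r' := fun ⟨x, u, z, v, hu, hv, hx, hy⟩ =>
    ⟨x, u, z, v, [], hu, hv, by simpa using hx, hy⟩
  simp only [phases, List.mem_cons, Prod.mk.injEq, List.not_mem_nil, or_false] at hij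
  rcases hij with h | h | h | h | h | h | h | h <;> obtain ⟨rfl, rfl⟩ := h
  · exact h2 (by simp)
  · exact h23 (h2 (by simp))
  · exact h2 (by simp)
  · exact h23 (h2 (by simp))
  · exact h4 (by simp)
  · exact h45 (h4 (by simp))
  · exact h4 (by simp)
  · exact h45 (h4 (by simp))

/-- Soundness, with `Phase` as the invariant along the path. The condition `1 ≤ i` keeps phase
vertices distinct from the accepting vertex. -/
theorem witness_of_path {x : ℕ × ℕ}
    (h : Relation.ReflTransGen (fun a b => (a, b) ∈ I.edges) (I.vertex 1 I.A.q₀ I.B.q₀) x) :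
    (x.2 = 0 ∧ I.Witness) ∨ ∃ i p r, x = I.vertex i p r ∧ I.Phase i p r ∧ 1 ≤ i := by
  induction h with
  | refl => exact Or.inr ⟨1, _, _, rfl, ⟨rfl, [], FinNFA.reads_nil.mpr rfl⟩, le_rfl⟩
  | @tail v w _ hvw ih =>
    rcases ih with ⟨h0, hW⟩ | ⟨i, p, r, rfl, hph, hi⟩
    -- The accepting vertex has no outgoing edge: every source has second component `6 * p + i` with
    -- `i ≥ 1`.
    · exfalso
      rcases of_mem_edges hvw with ⟨p, r, r', b, hb, rfl, rfl⟩ | ⟨f, hf, g, hg, rfl, rfl⟩ |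
        ⟨i, hi, p, p', a, r, ha, rfl, rfl⟩ | ⟨i, j, hij, p, p', r, r', a, ha, hb, rfl, rfl⟩
      · simp [vertex] at h0
      · simp [vertex] at h0
      · simp [vertex] at h0; omega
      · obtain ⟨-, rfl⟩ : (p : ℕ) = 0 ∧ i = 0 := by simp [vertex] at h0; omega
        simp [phases] at hij
    · have hi5 := hph.le
      rcases of_mem_edges hvw with ⟨p, r, r', b, hb, hv, rfl⟩ | ⟨f, hf, g, hg, hv, rfl⟩ |
        ⟨i, hi, p, p', a, r, ha, hv, rfl⟩ | ⟨i, j, hij, p, p', r, r', a, ha, hb, hv, rfl⟩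
      · obtain ⟨rfl, rfl, rfl⟩ := vertex_inj hi5 (by omega) hv
        exact Or.inr ⟨3, _, _, rfl, hph.insert hb, by omega⟩
      · obtain ⟨rfl, rfl, rfl⟩ := vertex_inj hi5 (by omega) hv
        obtain ⟨x, u, z, v, y, hu, hv, hA, hB⟩ := hph
        exact Or.inl ⟨rfl, x, u, z, v, y, hu, hv, FinNFA.mem_lang.mpr ⟨_, hf, hA⟩,
          FinNFA.mem_lang.mpr ⟨_, hg, hB⟩⟩
      · obtain ⟨rfl, rfl, rfl⟩ := vertex_inj hi5 (by omega) hv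
        exact Or.inr ⟨_, _, _, rfl, hph.left hi ha, by omega⟩
      · have hij' : i ≤ 5 ∧ 1 ≤ j := by
          simp only [phases, List.mem_cons, Prod.mk.injEq, List.not_mem_nil, or_false] at hij
          omega
        obtain ⟨rfl, rfl, rfl⟩ := vertex_inj hi5 hij'.1 hv
        exact Or.inr ⟨_, _, _, rfl, hph.both hij ha hb, hij'.2⟩

theorem path_left {i : ℕ} (hi : i = 1 ∨ i = 5) {p p' : Fin I.A.n} {w : List (Fin I.k)}
    (h : I.A.Reads p w p') (r : Fin I.B.n) :
    Relation.ReflTransGen (fun a b => (a, b) ∈ I.edges) (I.vertex i p r) (I.vertex i p' r) := by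
  induction w generalizing p with
  | nil => rw [FinNFA.reads_nil.mp h]
  | cons a w ih =>
    obtain ⟨s, hs, h⟩ := FinNFA.reads_cons.mp h
    exact .head (mem_edges_left hi hs r) (ih h)

theorem path_insert {r r' : Fin I.B.n} {w : List (Fin I.k)} (h : I.B.Reads r w r')
    (p : Fin I.A.n) :
    Relation.ReflTransGen (fun a b => (a, b) ∈ I.edges) (I.vertex 3 p r) (I.vertex 3 p r') := by
  induction w generalizing r with
  | nil => rw [FinNFA.reads_nil.mp h]
  | cons a w ih =>
    obtain ⟨s, hs, h⟩ := FinNFA.reads_cons.mp h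
    exact .head (mem_edges_insert hs) (ih h)

/-- The phases `i`, `m`, `e` are entry, intermediate and exit. The last letter makes the jump to
`e`, so a one-letter word goes from `i` to `e` directly, while the empty word has no such path. -/
theorem path_both {i m e : ℕ} (him : (i, m) ∈ phases) (hie : (i, e) ∈ phases)
    (hmm : (m, m) ∈ phases) (hme : (m, e) ∈ phases) {p p' : Fin I.A.n} {r r' : Fin I.B.n}
    {w : List (Fin I.k)} (hw : w ≠ []) (hA : I.A.Reads p w p') (hB : I.B.Reads r w r') :
    Relation.ReflTransGen (fun a b => (a, b) ∈ I.edges) (I.vertex i p r) (I.vertex e p' r') := by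
  induction w generalizing i p r with
  | nil => exact absurd rfl hw
  | cons a w ih =>
    obtain ⟨s, hs, hA⟩ := FinNFA.reads_cons.mp hA
    obtain ⟨t, ht, hB⟩ := FinNFA.reads_cons.mp hB
    cases w with
    | nil =>
      rw [FinNFA.reads_nil.mp hA, FinNFA.reads_nil.mp hB]
      exact .single (mem_edges_both hie hs ht)
    | cons b w => exact .head (mem_edges_both him hs ht) (ih hmm hme (by simp) hA hB)

theorem hits_iff_witness : Hits I.edges [((I.B.q₀ : ℕ), 6 * (I.A.q₀ : ℕ) + 1)] ↔ I.Witness := by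
  constructor
  · rintro ⟨w, hw, x, hx, h0⟩
    rw [List.mem_singleton.mp hw] at hx
    rcases witness_of_path hx with ⟨-, h⟩ | ⟨i, p, r, rfl, h, hi⟩
    · exact h
    · simp [vertex] at h0
      omega
  · rintro ⟨x, u, z, v, y, hu, hv, hA, hB⟩
    obtain ⟨f, hf, hA⟩ := FinNFA.mem_lang.mp hA
    obtain ⟨g, hg, hB⟩ := FinNFA.mem_lang.mp hB
    obtain ⟨p₃, hA, a₄⟩ := FinNFA.reads_append.mp hA
    obtain ⟨p₂, hA, a₃⟩ := FinNFA.reads_append.mp hA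
    obtain ⟨p₁, a₁, a₂⟩ := FinNFA.reads_append.mp hA
    obtain ⟨r₂, hB, b₃⟩ := FinNFA.reads_append.mp hB
    obtain ⟨r₁, b₁, b₂⟩ := FinNFA.reads_append.mp hB
    refine ⟨_, List.mem_singleton.mpr rfl, (0, 0), ?_, rfl⟩
    exact (((((path_left (Or.inl rfl) a₁ I.B.q₀).trans (path_both (i := 1) (m := 2) (e := 3)
      (by decide) (by decide) (by decide) (by decide) hu a₂ b₁)).trans (path_insert b₂ p₂)).trans
      (path_both (i := 3) (m := 4) (e := 5) (by decide) (by decide) (by decide) (by decide)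
        hv a₃ b₃)).trans (path_left (Or.inr rfl) a₄ g)).tail (mem_edges_accept hf hg)

end NFAPair

/-! ### Deciding SDI-freeness by reachability. -/

theorem isFree_sdi_iff {α : Type*} {L R : Language α} : IsFree sdi L R ↔
    ¬ ∃ x u z v y : List α, u ≠ [] ∧ v ≠ [] ∧ x ++ u ++ v ++ y ∈ L ∧ u ++ z ++ v ∈ R := by
  rw [IsFree, Set.eq_empty_iff_forall_notMem]
  constructor
  · rintro h ⟨x, u, z, v, y, hu, hv, hL, hR⟩
    exact h _ ⟨_, hL, _, hR, x, u, z, v, y, rfl, rfl, rfl, hu, hv⟩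
  · rintro h _ ⟨_, hL, _, hR, x, u, z, v, y, -, rfl, rfl, hu, hv⟩
    exact h ⟨x, u, z, v, y, hu, hv, hL, hR⟩

open Polynomial in
theorem decidableInPolyTime_isFree_sdi :
    DecidableInPolyTime NFAPair.enc (fun I => IsFree sdi I.A.lang I.B.lang) := by
  let C : Polynomial ℕ := 6 * X + 6
  let L : Polynomial ℕ := 48 * X * X
  refine decidableInPolyTime decideFree Reg.inp Reg.res
    -- This is `decideFreeTime` as a polynomial in the input length, which, the numbers being unary,
    -- bounds every number and every list length of the instance.
    (2 * (X * ((39 * X + 39) + 2) + X * ((39 * X + 39) + 4 * X + 5) +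
      X * (10 * (39 * X + 39) + 12 * X + 11) + 20 * X + 30) +
    (12 * X * (4 * X * (72 * C + 85) + 12 * C + 14) + 2) +
    ((L + 1) * (L * (76 * C + 109) + 16 * C + 21) + 1) +
    (4 * X * (3 * C + 4) + L * (4 * C + 5) + 2 * (L + 1) + 10) + 2 * X + 10)
    NFAPair.nums NFAPair.enc_eq_bits fun I => ?_
  have hlen := length_le_length_bits I.nums
  have hmem : ∀ n ∈ I.nums, n ≤ (bits I.nums).length := fun n hn => le_length_bits hn
  rw [← NFAPair.enc_eq_bits] at hlen hmem
  set B := I.enc.length with hB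
  simp only [NFAPair.nums, FinNFA.nums, List.length_cons, length_encN, length_encT,
    List.length_nil] at hlen
  have hk : I.k ≤ B := hmem _ List.mem_cons_self
  have hnA : I.A.n ≤ B := hmem _ (List.mem_cons_of_mem _ List.mem_cons_self)
  have hnB : I.B.n ≤ B :=
    hmem _ (List.mem_cons_of_mem _ (FinNFA.subset_nums _ _ List.mem_cons_self))
  have hF : ∀ M : FinNFA I.k, M.n ≤ B → ∀ f ∈ M.finals, f ≤ B := by
    intro M hM f hf
    obtain ⟨q, -, rfl⟩ := FinNFA.mem_finals.mp hf
    omega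
  have hT : ∀ M : FinNFA I.k, M.n ≤ B → Bounded B M.triples := by
    intro M hM t ht
    obtain ⟨p, q, a, -, rfl⟩ := FinNFA.mem_triples.mp ht
    simp only
    omega
  obtain ⟨b, hb, t, ht, hrun⟩ := decideFree_correct hk hnA (qA := I.A.q₀) (by omega) hnB
    (qB := I.B.q₀) (by omega) (hF _ hnA) (hF _ hnB) (hT _ hnA) (hT _ hnB)
    (by omega) (by omega) (by omega) (by omega)
  refine ⟨t, ht.trans (le_of_eq ?_), b, ?_, ?_⟩
  · simp [decideFreeTime, C, L]
  · rw [hb, isFree_sdi_iff]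
    exact not_congr NFAPair.hits_iff_witness
  · have h := Regs.update_get {}
    have e : (fun _ => [] : Reg → List ℕ) = ({} : Regs).get := by funext k; cases k <;> rfl
    rw [e, h, h]
    exact hrun

/-! ### Maximal and minimal insertions -/

theorem IsFree.of_nonempty_imp {α : Type*} {f g : List α → List α → Set (List α)} {L R : Language α}
    (h : ∀ x y, (f x y).Nonempty → (g x y).Nonempty) (hg : IsFree g L R) : IsFree f L R := by
  rw [IsFree, Set.eq_empty_iff_forall_notMem] at hg ⊢
  rintro w ⟨x, hx, y, hy, hw⟩
  obtain ⟨w', hw'⟩ := h x y ⟨w, hw⟩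
  exact hg w' ⟨x, hx, y, hy, hw'⟩

/-- An extension of the outfix takes letters from `x₁` or `x₂`, so extending must stop; induction on
the total length of these two words. -/
theorem maxSDI_nonempty_of_sdi {α : Type*} {x y : List α} (h : (sdi x y).Nonempty) :
    (maxSDI x y).Nonempty := by
  obtain ⟨_, x₁, u, z, v, x₂, -, hx, hy, hu, hv⟩ := h
  induction hn : x₁.length + x₂.length using Nat.strong_induction_on
    generalizing x₁ u z v x₂ with
  | _ n ih =>
    by_cases hmax : ∃ x₁' x₂' z' : List α, x₁' <:+ x₁ ∧ x₂' <+: x₂ ∧ x₁' ++ x₂' ≠ [] ∧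
      y = x₁' ++ u ++ z' ++ v ++ x₂'
    · obtain ⟨x₁', x₂', z', ⟨s, rfl⟩, ⟨t, rfl⟩, hne, hy'⟩ := hmax
      have hpos : 0 < x₁'.length + x₂'.length := by
        have := List.length_pos_iff.mpr hne
        rwa [List.length_append] at this
      exact ih (s.length + t.length) (by simp only [List.length_append] at hn; omega)
        s (x₁' ++ u) z' (v ++ x₂') t (by simp [hx]) (by simp [hy']) (by simp [hu]) (by simp [hv]) rfl
    · exact ⟨_, x₁, u, z, v, x₂, rfl, hx, hy, hu, hv, hmax⟩

/-- Passing to a proper border shortens `u` or `v` and keeps `x` and `y` fixed; induction on the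
total length of `u` and `v`. -/
theorem minSDI_nonempty_of_sdi {α : Type*} {x y : List α} (h : (sdi x y).Nonempty) :
    (minSDI x y).Nonempty := by
  obtain ⟨_, x₁, u, z, v, x₂, -, hx, hy, hu, hv⟩ := h
  induction hn : u.length + v.length using Nat.strong_induction_on
    generalizing x₁ u z v x₂ with
  | _ n ih =>
    by_cases h1 : ∃ b : List α, b ≠ [] ∧ b ≠ u ∧ b <:+ u ∧ b <+: u
    · obtain ⟨b, hb, hbu, ⟨s, hs⟩, ⟨t, ht⟩⟩ := h1
      have hl : b.length < u.length := by
        have h2 := congrArg List.length hs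
        rw [List.length_append] at h2
        have h3 : s ≠ [] := fun h => hbu (by rw [h] at hs; exact hs)
        have := List.length_pos_iff.mpr h3
        omega
      -- In `x` the border is the suffix of `u = s ++ b`, so `s` joins `x₁`; in `y` it is the prefix
      -- of `u = b ++ t`, so `t` joins the inserted part.
      refine ih (b.length + v.length) (by omega) (x₁ ++ s) b (t ++ z) v x₂ ?_ ?_ hb hv rfl
      · rw [hx, ← hs]; simp
      · rw [hy, ← ht]; simp
    · by_cases h2 : ∃ b : List α, b ≠ [] ∧ b ≠ v ∧ b <+: v ∧ b <:+ v
      · obtain ⟨b, hb, hbv, ⟨t, ht⟩, ⟨s, hs⟩⟩ := h2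
        have hl : b.length < v.length := by
          have h2 := congrArg List.length hs
          rw [List.length_append] at h2
          have h3 : s ≠ [] := fun h => hbv (by rw [h] at hs; exact hs)
          have := List.length_pos_iff.mpr h3
          omega
        refine ih (u.length + b.length) (by omega) x₁ u (z ++ s) b (t ++ x₂) ?_ ?_ hu hb rfl
        · rw [hx, ← ht]; simp
        · rw [hy, ← hs]; simp
      · exact ⟨_, x₁, u, z, v, x₂, rfl, hx, hy, hu, hv, h1, h2⟩

theorem isFree_maxSDI_iff {α : Type*} (L R : Language α) :
    IsFree maxSDI L R ↔ IsFree sdi L R := by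
  refine ⟨IsFree.of_nonempty_imp fun _ _ => maxSDI_nonempty_of_sdi,
    IsFree.of_nonempty_imp fun _ _ => ?_⟩
  rintro ⟨w, x₁, u, z, v, x₂, h1, h2, h3, h4, h5, -⟩
  exact ⟨w, x₁, u, z, v, x₂, h1, h2, h3, h4, h5⟩

theorem isFree_minSDI_iff {α : Type*} (L R : Language α) :
    IsFree minSDI L R ↔ IsFree sdi L R := by
  refine ⟨IsFree.of_nonempty_imp fun _ _ => minSDI_nonempty_of_sdi,
    IsFree.of_nonempty_imp fun _ _ => ?_⟩
  rintro ⟨w, x₁, u, z, v, x₂, h1, h2, h3, h4, h5, -⟩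
  exact ⟨w, x₁, u, z, v, x₂, h1, h2, h3, h4, h5⟩

end SDI

theorem corollary1 :
    SDI.DecidableInPolyTime SDI.NFAPair.enc
      (fun I => SDI.IsFree SDI.maxSDI I.A.lang I.B.lang) ∧
    SDI.DecidableInPolyTime SDI.NFAPair.enc
      (fun I => SDI.IsFree SDI.minSDI I.A.lang I.B.lang) ∧
    (∀ (α : Type) (L R : Language α),
      (SDI.IsFree SDI.maxSDI L R ↔ SDI.IsFree SDI.sdi L R) ∧
      (SDI.IsFree SDI.minSDI L R ↔ SDI.IsFree SDI.sdi L R)) := by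
  refine ⟨?_, ?_, fun α L R => ⟨SDI.isFree_maxSDI_iff L R, SDI.isFree_minSDI_iff L R⟩⟩
  · simp only [SDI.isFree_maxSDI_iff]
    exact SDI.decidableInPolyTime_isFree_sdi
  · simp only [SDI.isFree_minSDI_iff]
    exact SDI.decidableInPolyTime_isFree_sdi
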